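/- Let $V=\bigoplus_{i\ge 0}\mathbb Q\,b_i$ with dual forms $\beta_j$, $\beta_j(b_i)=\delta_{ij}$. For $r\ge 0$ let $\mathcal P_r$ be the set of partitions $\lambda=(\lambda_1\ge\dots\ge\lambda_r\ge 0)$ of length at most $r$ (so $\mathcal P_r\subseteq\mathcal P_{r+1}$), and put $$[\mathbf b]^r_\lambda=b_{r-1+\lambda_1}\wedge b_{r-2+\lambda_2}\wedge\dots\wedge b_{\lambda_r}\in\textstyle\bigwedge^rV,\qquad [\boldsymbol\beta]^r_\lambda=\beta_{r-1+\lambda_1}\wedge\dots\wedge\beta_{\lambda_r}.$$ Contraction $\xi\lrcorner:\bigwedge^rV\to\bigwedge^{r-k}V$ against a form $\xi$ of degree $k$ is given by $\eta(\xi\lrcorner u)=(\xi\wedge\eta)(u)$ for all forms $\eta$ of degree $r-k$, for the determinantal pairing $(\beta_{i_1}\wedge\dots\wedge\beta_{i_r})(v_1\wedge\dots\wedge v_r)=\det(\beta_{i_p}(v_q))$; it is $0$ if $k>r$. *Schubert derivations.* A Hasse–Schmidt derivation is a linear map $D(z):\bigwedge V\to\bigwedge V[[z]]$ with $D(z)1=1$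 and $D(z)(u\wedge v)=D(z)u\wedge D(z)v$. Let $\sigma_+(z),\overline\sigma_+(z)$ (in powers of $z$) and $\sigma_-(z),\overline\sigma_-(z)$ (in powers of $z^{-1}$) be the Hasse–Schmidt derivations with $$\sigma_+(z)b_j=\sum_{i\ge0}b_{j+i}z^i,\quad \overline\sigma_+(z)b_j=b_j-b_{j+1}z,\quad \sigma_-(z)b_j=\sum_{i\ge0}b_{j-i}z^{-i},\quad \overline\sigma_-(z)b_j=b_j-b_{j-1}z^{-1},$$ where $b_i=0$ for $i<0$. For $\mathbf z_k=(z_1,\dots,z_k)$ and each of these derivations write $\sigma(\mathbf z_k)=\sigma(z_1)\cdots\sigma(z_k)$. All operators are extended linearly to coefficients that are Laurent polynomials in the other variables. *The ring $B_r$.* Let $B_r=\mathbb Q[e_1,\dots,e_r]$, $E_r(z)=1-e_1z+\dots+(-1)^re_rz^r$ and $H_r=(h_n)_{n\in\mathbb Z}$ with $\sum_nh_nz^n=1/E_r(z)$. For a sequence $H=(H_n)_{n\in\mathbb Z}$ and $\lambda\in\mathcal P_r$ let $\Delta_\lambda(H)=\det(H_{\lambda_j-j+i})_{1\le i,j\le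 r}$. Let $B_r$ act on $\bigwedge^rV$ by $e_iu=\overline\sigma_iu$, where $\overline\sigma_+(z)=\sum_i(-1)^i\overline\sigma_iz^i$. For $\mu,\nu\in\mathcal P_k$ let $\mathcal E^k_{\mu\nu}=[\mathbf b]^k_\mu\otimes[\boldsymbol\beta]^k_\nu$ act linearly on $B_r$ by transporting the endomorphism $u\mapsto[\mathbf b]^k_\mu\wedge([\boldsymbol\beta]^k_\nu\lrcorner u)$ of $\bigwedge^rV$ along the isomorphism $B_r\to\bigwedge^rV$, $p\mapsto p\,[\mathbf b]^r_0$, whose inverse is $[\mathbf b]^r_\lambda\mapsto\Delta_\lambda(H_r)$. Put $$\mathcal E(\mathbf z_k,\mathbf w_k^{-1})=\sum_{\mu,\nu\in\mathcal P_k}\mathcal E^k_{\mu\nu}\,s_\mu(\mathbf z_k)\,s_\nu(\mathbf w_k^{-1}),$$ where $s_\mu(x_1,\dots,x_k)$ is the Schur polynomial, defined by $\det(x_j^{\mu_{k-i+1}+i-1})=s_\mu\cdot\det(x_j^{i-1})$. *Vertex operators.* For $m\ge0$ let $\sigma_-(w)$ act on sequences with $H_n=0$ for $n<0$ by $(\sigma_-(w)H)_n=\sum_{i\ge0}H_{n-i}w^{-i}$,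 and put $\sigma_-(\mathbf w_k)H_m=\sigma_-(w_1)\cdots\sigma_-(w_k)H_m$. Define linear operators on $\bigwedge V$ by $$\Gamma(\mathbf z_k)[\mathbf b]^r_\lambda=\sigma_+(\mathbf z_k)\,\overline\sigma_-(\mathbf z_k)[\mathbf b]^{r+k}_\lambda,\qquad \Gamma^*(\mathbf w_k)[\mathbf b]^r_\lambda=\overline\sigma_+(\mathbf w_k)\Big(\Delta_\lambda\big(\sigma_-(\mathbf w_k)H_{r-k}\big)[\mathbf b]^{r-k}_0\Big),$$ for $\lambda\in\mathcal P_r$, with $\Gamma^*(\mathbf w_k)=0$ on $\bigwedge^rV$ if $k>r$. **Theorem.** Let $k,r\ge0$ and $\lambda\in\mathcal P_r$. 1. The map $p\mapsto p\,[\mathbf b]^r_0$ is a bijection $B_r\to\bigwedge^rV$, and $\Delta_\lambda(H_r)[\mathbf b]^r_0=[\mathbf b]^r_\lambda$. Hence $(\mathcal E^k_{\mu\nu}\Delta_\lambda(H_r))[\mathbf b]^r_0=[\mathbf b]^k_\mu\wedge([\boldsymbol\beta]^k_\nu\lrcorner[\mathbf b]^r_\lambda)$ for all $\mu,\nu\in\mathcal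 P_k$. 2. If $r\ge1$, then $\sigma_-(z)(h_n[\mathbf b]^r_0)=\sum_{i\ge0}(h_{n-i}[\mathbf b]^r_0)z^{-i}$ for all $n\in\mathbb Z$; so the sequence $\sigma_-(z)H_r$ used above is the one induced by the Schubert derivation $\sigma_-(z)$ on $\bigwedge^rV$. 3. As formal Laurent series in $\mathbf z_k,\mathbf w_k$ with coefficients in $\bigwedge^rV$, $$\Big(\mathcal E(\mathbf z_k,\mathbf w_k^{-1})\,\Delta_\lambda(H_r)\Big)[\mathbf b]^r_0=\prod_{j=1}^k\Big(\frac{z_j}{w_j}\Big)^{r-k}\Gamma(\mathbf z_k)\,\Gamma^*(\mathbf w_k)\,[\mathbf b]^r_\lambda .$$ -/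

import Mathlib

noncomputable section

namespace ExtVertex

/-! ### The space `V`, its exterior algebra, and the bases indexed by partitions -/

/-- `V = ⨁_{i ≥ 0} ℚ · b_i`. -/
abbrev V : Type := ℕ →₀ ℚ

/-- The exterior algebra `⋀ V`; its product is the wedge product. -/
abbrev ExtV : Type := ExteriorAlgebra ℚ V

/-- The basis vector `b_n` of `V`. -/
def b (n : ℕ) : V := Finsupp.single n 1

/-- The dual basis form `β_n`, with `β_n (b_m) = δ_{n m}`. -/
def β (n : ℕ) : Module.Dual ℚ V := Finsupp.lapply n

/-- Partitions of length at most `r`, written `λ_1 ≥ ... ≥ λ_r ≥ 0`. The part `λ_{i+1}` is the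
value at `i : Fin r`. -/
abbrev Ptn (r : ℕ) : Type := {l : Fin r → ℕ // Antitone l}

/-- The index `r - (i+1) + λ_{i+1}` of the `(i+1)`-st factor of `[b]^r_λ` (here `i < r`, so that the
subtraction is a true one). -/
def idx {r : ℕ} (l : Fin r → ℕ) (i : Fin r) : ℕ := r - 1 - (i : ℕ) + l i

/-- `[b]^r_λ = b_{r-1+λ_1} ∧ b_{r-2+λ_2} ∧ ... ∧ b_{λ_r}`. -/
def bWedge {r : ℕ} (l : Fin r → ℕ) : ExtV :=
  ExteriorAlgebra.ιMulti ℚ r fun i => b (idx l i)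

/-- The contraction `[β]^k_ν ⌟ _` against `[β]^k_ν = β_{k-1+ν_1} ∧ ... ∧ β_{ν_k}`. For one form `β`,
`β ⌟ _` is the antiderivation with `β ⌟ v = β v` (that is, `η (β ⌟ u) = (β ∧ η) u`). The rule
`η (ξ ⌟ u) = (ξ ∧ η) u` forces `(β_{i_1} ∧ ... ∧ β_{i_k}) ⌟ u = β_{i_k} ⌟ (... (β_{i_1} ⌟ u))`:
the first factor acts first. -/
def contract {k : ℕ} (n : Fin k → ℕ) : Module.End ℚ ExtV :=
  ((List.ofFn fun i => (CliffordAlgebra.contractLeft (β (idx n i)) : Module.End ℚ ExtV)).reverse).prod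

/-! ### Hasse-Schmidt derivations and Schubert derivations -/

/-- The map `v ↦ ∑ i, f_i(v) z^i` from `V` to `⋀V⟦z⟧`. -/
def hsOnV (f : ℕ → Module.End ℚ V) : V →ₗ[ℚ] PowerSeries ExtV where
  toFun v := PowerSeries.mk fun i => ExteriorAlgebra.ι ℚ (f i v)
  map_add' u v := by ext i; simp
  map_smul' c v := by ext i; simp

lemma hsOnV_sq (f : ℕ → Module.End ℚ V) (v : V) : hsOnV f v * hsOnV f v = 0 := by
  ext n
  rw [PowerSeries.coeff_mul]
  simp only [hsOnV, LinearMap.coe_mk, AddHom.coe_mk, PowerSeries.coeff_mk, map_zero]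
  set S := ∑ p ∈ Finset.HasAntidiagonal.antidiagonal n,
    ExteriorAlgebra.ι ℚ (f p.1 v) * ExteriorAlgebra.ι ℚ (f p.2 v) with hS
  have h1 : S = ∑ p ∈ Finset.HasAntidiagonal.antidiagonal n,
      ExteriorAlgebra.ι ℚ (f p.2 v) * ExteriorAlgebra.ι ℚ (f p.1 v) :=
    (Finset.Nat.sum_antidiagonal_swap
      (f := fun p : ℕ × ℕ => ExteriorAlgebra.ι ℚ (f p.1 v) * ExteriorAlgebra.ι ℚ (f p.2 v))).symm
  have h2 : S + S = 0 := by
    nth_rewrite 2 [h1]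
    rw [hS, ← Finset.sum_add_distrib]
    exact Finset.sum_eq_zero fun p _ => ExteriorAlgebra.ι_add_mul_swap _ _
  have h3 : (2 : ℚ) • S = 0 := by rw [two_smul, h2]
  exact (smul_eq_zero.1 h3).resolve_left two_ne_zero

/-- The unique Hasse-Schmidt derivation `D(z) : ⋀V → ⋀V⟦z⟧` (a linear map with
`D(z)(u ∧ v) = D(z)u ∧ D(z)v` and `D(z) 1 = 1`) such that `D(z) v = ∑ i, f_i(v) z^i` for `v ∈ V`. -/
def hsDer (f : ℕ → Module.End ℚ V) : ExtV →ₐ[ℚ] PowerSeries ExtV :=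
  ExteriorAlgebra.lift ℚ ⟨hsOnV f, hsOnV_sq f⟩

/-- The coefficient of `z^n` in `hsDer f`, an endomorphism of `⋀V`. -/
def hsCoeff (f : ℕ → Module.End ℚ V) (n : ℕ) : Module.End ℚ ExtV where
  toFun u := PowerSeries.coeff n (hsDer f u)
  map_add' u v := by simp
  map_smul' c u := by simp

/-- `σ_1 b_j = b_{j+1}`. -/
def up : Module.End ℚ V := Finsupp.linearCombination ℚ fun j => b (j + 1)

/-- `σ_{-1} b_j = b_{j-1}` for `j ≥ 1`, and `σ_{-1} b_0 = 0`. -/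
def down : Module.End ℚ V := Finsupp.linearCombination ℚ fun j => if j = 0 then 0 else b (j - 1)

/-- The coefficients of `1 + φ z + φ² z² + ...`. -/
def geo (φ : Module.End ℚ V) : ℕ → Module.End ℚ V := fun i => φ ^ i

/-- The coefficients of `1 - φ z`, the inverse of `1 + φ z + φ² z² + ...`. -/
def geoInv (φ : Module.End ℚ V) : ℕ → Module.End ℚ V :=
  fun i => if i = 0 then 1 else if i = 1 then -φ else 0

/-- The coefficient of `z^n`, `n : ℤ`, in the Schubert derivation `σ₊(z)`, the HS-derivation with
`σ₊(z) b_j = ∑_{i ≥ 0} b_{j+i} z^i`. -/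
def sigmaPlus (n : ℤ) : Module.End ℚ ExtV := if 0 ≤ n then hsCoeff (geo up) n.toNat else 0

/-- The coefficient of `z^n`, `n : ℤ`, in `σ̄₊(z)`, the HS-derivation with
`σ̄₊(z) b_j = b_j - b_{j+1} z`. -/
def sigmaBarPlus (n : ℤ) : Module.End ℚ ExtV := if 0 ≤ n then hsCoeff (geoInv up) n.toNat else 0

/-- The coefficient of `z^n`, `n : ℤ`, in `σ₋(z)`, the HS-derivation (in powers of `z⁻¹`) with
`σ₋(z) b_j = ∑_{i ≥ 0} b_{j-i} z^{-i}`. -/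
def sigmaMinus (n : ℤ) : Module.End ℚ ExtV := if n ≤ 0 then hsCoeff (geo down) (-n).toNat else 0

/-- The coefficient of `z^n`, `n : ℤ`, in `σ̄₋(z)`, the HS-derivation (in powers of `z⁻¹`) with
`σ̄₋(z) b_j = b_j - b_{j-1} z⁻¹`. -/
def sigmaBarMinus (n : ℤ) : Module.End ℚ ExtV :=
  if n ≤ 0 then hsCoeff (geoInv down) (-n).toNat else 0

/-- If `D n` is the coefficient of `z^n` in `D(z)`, then `multi D a` is the coefficient of
`z_1^{a_1} ⋯ z_k^{a_k}` in `D(z_1) ∘ ⋯ ∘ D(z_k)`. -/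
def multi (D : ℤ → Module.End ℚ ExtV) {k : ℕ} (a : Fin k → ℤ) : Module.End ℚ ExtV :=
  (List.ofFn fun j => D (a j)).prod

/-! ### The ring `B_r` and its identification with `⋀^r V` -/

/-- `B_r = ℚ[e_1, ..., e_r]`; the variable `e_{i+1}` is `MvPolynomial.X i`, `i : Fin r`. -/
abbrev B (r : ℕ) : Type := MvPolynomial (Fin r) ℚ

/-- `e_i ∈ B_r`, with `e_0 = 1` and `e_i = 0` for `i > r`. -/
def e (r i : ℕ) : B r :=
  if i = 0 then 1 else if h : i - 1 < r then MvPolynomial.X ⟨i - 1, h⟩ else 0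

/-- `E_r(z) = 1 - e_1 z + ⋯ + (-1)^r e_r z^r`. -/
def Epoly (r : ℕ) : PowerSeries (B r) := PowerSeries.mk fun i => (-1) ^ i * e r i

/-- The sequence `H_r = (h_n)_{n ∈ ℤ}` with `∑ h_n z^n = 1 / E_r(z)`. -/
def hSeq (r : ℕ) (n : ℤ) : B r :=
  if 0 ≤ n then PowerSeries.coeff n.toNat (PowerSeries.invOfUnit (Epoly r) 1) else 0

lemma Epoly_mul_inv (r : ℕ) : Epoly r * PowerSeries.invOfUnit (Epoly r) 1 = 1 :=
  PowerSeries.mul_invOfUnit _ _ (by simp [Epoly, e, ← PowerSeries.coeff_zero_eq_constantCoeff_apply])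

/-- The Schur determinant `Δ_λ(H) = det (H_{λ_j - j + i})_{1 ≤ i, j ≤ r}` of a sequence `H`. -/
def schurDet {R : Type*} [CommRing R] {r : ℕ} (H : ℤ → R) (l : Fin r → ℕ) : R :=
  Matrix.det (Matrix.of fun i j : Fin r => H ((l j : ℤ) - (j : ℤ) + (i : ℤ)))

/-- The alternating map `V^r → R` with value `det (H_{n_j - r + i})_{1 ≤ i, j ≤ r}` at
`(b_{n_1}, ..., b_{n_r})`; its value at the factors of `[b]^r_λ` is `Δ_λ(H)`. -/
def schurAlt {R : Type*} [CommRing R] [Algebra ℚ R] (H : ℤ → R) (r : ℕ) : V [⋀^Fin r]→ₗ[ℚ] R :=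
  AlternatingMap.compLinearMap
    { (Matrix.detRowAlternating (n := Fin r) (R := R)).toMultilinearMap.restrictScalars ℚ with
      map_eq_zero_of_eq' := fun v _ _ h hij =>
        (Matrix.detRowAlternating (n := Fin r) (R := R)).map_eq_zero_of_eq v h hij }
    (Finsupp.linearCombination ℚ fun (n : ℕ) (i : Fin r) => H ((n : ℤ) - (r : ℤ) + 1 + (i : ℤ)))

lemma schurAlt_apply {R : Type*} [CommRing R] [Algebra ℚ R] (H : ℤ → R) {r : ℕ} (l : Fin r → ℕ) :
    schurAlt H r (fun i => b (idx l i)) = schurDet H l := by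
  rw [schurDet, ← Matrix.det_transpose]
  change Matrix.det _ = _
  congr 1
  ext j i
  have hj : (j : ℕ) < r := j.2
  simp only [b, Finsupp.linearCombination_single, one_smul, Matrix.transpose_apply,
    Matrix.of_apply, idx]
  congr 1
  have : ((r - 1 - (j : ℕ) + l j : ℕ) : ℤ) = (r : ℤ) - 1 - (j : ℤ) + (l j : ℤ) := by omega
  rw [this]
  ring

/-- The operator on `⋀V` by which `e_{i+1}` acts: `e_i u = σ̄_i u`, where
`σ̄₊(z) = ∑ (-1)^i σ̄_i z^i`. -/
def eAct (i : ℕ) : Module.End ℚ ExtV := (-1 : ℚ) ^ i • sigmaBarPlus (i : ℤ)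

/-- The map `B_r → ⋀^r V`, `p ↦ p · [b]^r_0`, where `e_i` acts on `⋀^r V` as `σ̄_i`: the monomial
`∏ e_i^{m_i}` goes to `σ̄_1^{m_1} ⋯ σ̄_r^{m_r} [b]^r_0`. -/
def toWedge (r : ℕ) : B r →ₗ[ℚ] ExtV :=
  (MvPolynomial.basisMonomials (Fin r) ℚ).constr ℚ fun m =>
    (List.ofFn fun i : Fin r => eAct ((i : ℕ) + 1) ^ m i).prod (bWedge (0 : Fin r → ℕ))

/-- The linear map `⋀V → B_r` with `[b]^r_λ ↦ Δ_λ(H_r)`, extended by `0` to the other degrees. -/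
def ofWedge (r : ℕ) : ExtV →ₗ[ℚ] B r :=
  ExteriorAlgebra.liftAlternating (Pi.single r (schurAlt (hSeq r) r))

lemma ofWedge_bWedge {r : ℕ} (l : Fin r → ℕ) : ofWedge r (bWedge l) = schurDet (hSeq r) l := by
  rw [ofWedge, bWedge, ExteriorAlgebra.liftAlternating_apply_ιMulti, Pi.single_eq_same,
    schurAlt_apply]

/-- The action of `ℰ^k_{μν} = [b]^k_μ ⊗ [β]^k_ν` on `B_r`: the endomorphism
`u ↦ [b]^k_μ ∧ ([β]^k_ν ⌟ u)` of `⋀^r V`, transported to `B_r`. -/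
def glAct {k : ℕ} (r : ℕ) (m n : Fin k → ℕ) : B r →ₗ[ℚ] B r :=
  ofWedge r ∘ₗ LinearMap.mulLeft ℚ (bWedge m) ∘ₗ contract n ∘ₗ toWedge r

/-! ### Schur polynomials -/

/-- The alternant `det (x_j^{λ_{k-i+1} + i - 1})_{1 ≤ i, j ≤ k}`. -/
def alternant {k : ℕ} (l : Fin k → ℕ) : MvPolynomial (Fin k) ℚ :=
  Matrix.det (Matrix.of fun i j : Fin k =>
    (MvPolynomial.X j : MvPolynomial (Fin k) ℚ) ^ (l i.rev + (i : ℕ)))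

lemma alternant_zero (k : ℕ) : alternant (0 : Fin k → ℕ) =
    ∏ i : Fin k, ∏ j ∈ Finset.Ioi i, (MvPolynomial.X j - MvPolynomial.X i) := by
  rw [← Matrix.det_vandermonde, ← Matrix.det_transpose, alternant]
  congr 1
  ext i j
  simp [Matrix.vandermonde_apply]

lemma alternant_zero_ne_zero (k : ℕ) : alternant (0 : Fin k → ℕ) ≠ 0 := by
  rw [alternant_zero]
  refine Finset.prod_ne_zero_iff.2 fun i _ => Finset.prod_ne_zero_iff.2 fun j hj => ?_
  rw [sub_ne_zero]
  intro h
  exact (Finset.mem_Ioi.1 hj).ne' (MvPolynomial.X_injective h)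

lemma X_sub_X_dvd_alternant {k : ℕ} (l : Fin k → ℕ) {i j : Fin k} (hij : i ≠ j) :
    (MvPolynomial.X j - MvPolynomial.X i : MvPolynomial (Fin k) ℚ) ∣ alternant l := by
  rw [← Ideal.mem_span_singleton, ← Ideal.Quotient.eq_zero_iff_mem, alternant, RingHom.map_det]
  refine Matrix.det_zero_of_column_eq hij fun m => ?_
  simp only [RingHom.mapMatrix_apply, Matrix.map_apply, Matrix.of_apply, map_pow]
  congr 1
  exact (Ideal.Quotient.eq.2 (Ideal.mem_span_singleton_self _)).symm

lemma irreducible_X_sub_X {k : ℕ} {i j : Fin k} (hij : i ≠ j) :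
    Irreducible (MvPolynomial.X j - MvPolynomial.X i : MvPolynomial (Fin k) ℚ) := by
  have h1 : MvPolynomial.coeff (Finsupp.single j 1)
      (MvPolynomial.X j - MvPolynomial.X i : MvPolynomial (Fin k) ℚ) = 1 := by
    simp [MvPolynomial.coeff_X, Finsupp.single_left_inj, hij]
  apply MvPolynomial.irreducible_of_totalDegree_eq_one
  · apply le_antisymm
    · refine (MvPolynomial.totalDegree_sub _ _).trans ?_
      simp
    · have := MvPolynomial.le_totalDegree (s := Finsupp.single j 1)
        (p := (MvPolynomial.X j - MvPolynomial.X i : MvPolynomial (Fin k) ℚ))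
        (by rw [MvPolynomial.mem_support_iff, h1]; exact one_ne_zero)
      simpa using this
  · intro x hx
    have := hx (Finsupp.single j 1)
    rw [h1] at this
    exact isUnit_of_dvd_one this

lemma exists_schur {k : ℕ} (l : Fin k → ℕ) : alternant (0 : Fin k → ℕ) ∣ alternant l := by
  rw [alternant_zero, Finset.prod_sigma']
  apply Finset.prod_dvd_of_isRelPrime
  · rintro ⟨i, j⟩ h ⟨i', j'⟩ h' hne
    have hij : i < j := by simpa using h
    have hij' : i' < j' := by simpa using h'
    rw [Function.onFun, (irreducible_X_sub_X hij.ne).isRelPrime_iff_not_dvd]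
    rintro ⟨q, hq⟩
    have := congrArg (MvPolynomial.eval fun m : Fin k =>
      if m = i ∨ m = j then (0 : ℚ) else (m : ℚ) + 1) hq
    simp only [map_sub, map_mul, MvPolynomial.eval_X, true_or, or_true, if_true, sub_zero,
      zero_mul, sub_eq_zero] at this
    have hp (m : Fin k) : ((m : ℕ) : ℚ) + 1 ≠ 0 := by positivity
    split_ifs at this with h1 h2 h2
    · apply hne
      have e1 : i' = i := by omega
      have e2 : j' = j := by omega
      rw [e1, e2]
    · exact hp _ this.symm
    · exact hp _ this
    · exact hij'.ne' (Fin.ext (by exact_mod_cast add_right_cancel this))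
  · rintro ⟨i, j⟩ h
    have hij : i < j := by simpa using h
    exact X_sub_X_dvd_alternant l hij.ne

/-- The Schur polynomial `s_λ(x_1, ..., x_k)`, the quotient of the alternant of `λ` by the
Vandermonde determinant (the alternant of the zero partition). -/
def schur {k : ℕ} (l : Fin k → ℕ) : MvPolynomial (Fin k) ℚ := (exists_schur l).choose

lemma alternant_eq {k : ℕ} (l : Fin k → ℕ) : alternant l = alternant 0 * schur l :=
  (exists_schur l).choose_spec

lemma alternant_isHomogeneous {k : ℕ} (l : Fin k → ℕ) :
    (alternant l).IsHomogeneous (∑ i, l i + ∑ i : Fin k, (i : ℕ)) := by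
  rw [alternant, Matrix.det_apply]
  refine MvPolynomial.IsHomogeneous.sum _ _ _ fun s _ => ?_
  have h : (∏ i, Matrix.of (fun i j : Fin k =>
      (MvPolynomial.X j : MvPolynomial (Fin k) ℚ) ^ (l i.rev + (i : ℕ))) (s i) i).IsHomogeneous
      (∑ i, l i + ∑ i : Fin k, (i : ℕ)) := by
    have e1 : ∑ i, l i + ∑ i : Fin k, (i : ℕ) = ∑ i, (l (s i).rev + (s i : ℕ)) := by
      rw [Equiv.sum_comp s fun i : Fin k => l i.rev + (i : ℕ), Finset.sum_add_distrib]
      congr 1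
      exact (Equiv.sum_comp Fin.revPerm l).symm
    rw [e1]
    refine MvPolynomial.IsHomogeneous.prod _ _ _ fun i _ => ?_
    simpa using (MvPolynomial.isHomogeneous_X ℚ i).pow (l (s i).rev + (s i : ℕ))
  rcases Int.units_eq_one_or (Equiv.Perm.sign s) with hs | hs <;> rw [hs]
  · simpa using h
  · simpa using h.neg

lemma schur_isHomogeneous {k : ℕ} (l : Fin k → ℕ) : (schur l).IsHomogeneous (∑ i, l i) := by
  have key (d : ℕ) (hd : d ≠ ∑ i, l i) : MvPolynomial.homogeneousComponent d (schur l) = 0 := by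
    have h0 := alternant_isHomogeneous (0 : Fin k → ℕ)
    have h1 := congrArg (MvPolynomial.homogeneousComponent (d + ∑ i : Fin k, (i : ℕ)))
      (alternant_eq l)
    rw [MvPolynomial.homogeneousComponent_of_mem (alternant_isHomogeneous l), if_neg (by omega)]
      at h1
    conv_rhs at h1 => rw [← MvPolynomial.sum_homogeneousComponent (schur l), Finset.mul_sum, map_sum]
    have h2 : ∀ i ∈ Finset.range ((schur l).totalDegree + 1),
        MvPolynomial.homogeneousComponent (d + ∑ i : Fin k, (i : ℕ))
          (alternant 0 * MvPolynomial.homogeneousComponent i (schur l)) =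
        if d = i then alternant 0 * MvPolynomial.homogeneousComponent i (schur l) else 0 := by
      intro i _
      rw [MvPolynomial.homogeneousComponent_of_mem
        (h0.mul (MvPolynomial.homogeneousComponent_isHomogeneous i (schur l)))]
      refine if_congr ?_ rfl rfl
      simp only [Pi.zero_apply, Finset.sum_const_zero]
      omega
    rw [Finset.sum_congr rfl h2, Finset.sum_ite_eq] at h1
    split_ifs at h1 with h3
    · exact (mul_eq_zero.1 h1.symm).resolve_left (alternant_zero_ne_zero k)
    · exact MvPolynomial.homogeneousComponent_eq_zero _ _ (by simpa using h3)
  rw [← MvPolynomial.sum_homogeneousComponent (schur l)]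
  refine MvPolynomial.IsHomogeneous.sum _ _ _ fun d _ => ?_
  by_cases hd : d = ∑ i, l i
  · subst hd
    exact MvPolynomial.homogeneousComponent_isHomogeneous _ _
  · rw [key d hd]
    exact MvPolynomial.isHomogeneous_zero _ _ _

/-- The coefficient of `x^a`, `a ∈ ℤ^k`, in a polynomial in `x_1, ..., x_k`. -/
def coeffZ {k : ℕ} (P : MvPolynomial (Fin k) ℚ) (a : Fin k → ℤ) : ℚ :=
  if ∀ j, 0 ≤ a j then P.coeff (Finsupp.equivFunOnFinite.symm fun j => (a j).toNat) else 0

lemma coeffZ_schur_finite {k : ℕ} (a : Fin k → ℤ) :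
    {m : Ptn k | coeffZ (schur m.1) a ≠ 0}.Finite := by
  have h : {f : Fin k → ℕ | ∀ i, f i ≤ ∑ j, (a j).toNat}.Finite := by
    have := Set.finite_Iic (fun _ : Fin k => ∑ j, (a j).toNat)
    exact this
  refine (h.preimage (f := (Subtype.val : Ptn k → Fin k → ℕ))
    Subtype.val_injective.injOn).subset fun m hm i => ?_
  simp only [Set.mem_ofPred_eq, coeffZ] at hm
  split_ifs at hm with h0
  · have h1 := schur_isHomogeneous m.1 hm
    have h2 : ∑ j, (a j).toNat = ∑ j, m.1 j := by
      rw [← h1, Finsupp.weight_apply, Finsupp.sum_fintype _ _ (by simp)]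
      simp
    rw [h2]
    exact Finset.single_le_sum (f := m.1) (fun _ _ => Nat.zero_le _) (Finset.mem_univ i)
  · exact absurd rfl hm

lemma genAct_support_finite (k r : ℕ) (a c : Fin k → ℤ) (p : B r) :
    (Function.support fun q : Ptn k × Ptn k =>
      (coeffZ (schur q.1.1) a * coeffZ (schur q.2.1) (-c)) • glAct r q.1.1 q.2.1 p).Finite := by
  refine ((coeffZ_schur_finite a).prod (coeffZ_schur_finite (-c))).subset fun q hq => ?_
  have h := left_ne_zero_of_smul hq
  exact ⟨left_ne_zero_of_mul h, right_ne_zero_of_mul h⟩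

/-- The generating function `ℰ(z_k, w_k⁻¹) = ∑_{μ, ν} ℰ^k_{μν} s_μ(z_k) s_ν(w_k⁻¹)` acting on
`p ∈ B_r`: the coefficient of `z^a w^c`. By `genAct_support_finite` the sum is finite. -/
def genAct (k r : ℕ) (a c : Fin k → ℤ) (p : B r) : B r :=
  ∑ᶠ q : Ptn k × Ptn k,
    (coeffZ (schur q.1.1) a * coeffZ (schur q.2.1) (-c)) • glAct r q.1.1 q.2.1 p

/-! ### Vertex operators -/

/-- The linear map `⋀V → ⋀V`, `[b]^r_λ ↦ [b]^{r+k}_λ`, namely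
`u ↦ (⋀ σ_1^k) u ∧ b_{k-1} ∧ ⋯ ∧ b_0`. -/
def raise (k : ℕ) : Module.End ℚ ExtV :=
  LinearMap.mulRight ℚ (bWedge (0 : Fin k → ℕ)) ∘ₗ (ExteriorAlgebra.map (up ^ k)).toLinearMap

lemma up_pow_b (k n : ℕ) : (up ^ k) (b n) = b (n + k) := by
  induction k with
  | zero => simp
  | succ k ih =>
    rw [pow_succ', Module.End.mul_apply, ih, up, b, Finsupp.linearCombination_single, one_smul]
    rfl

lemma raise_bWedge (k : ℕ) {r : ℕ} (l : Fin r → ℕ) :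
    raise k (bWedge l) =
      bWedge (fun i : Fin (r + k) => if h : (i : ℕ) < r then l ⟨i, h⟩ else 0) := by
  rw [raise, LinearMap.comp_apply, LinearMap.mulRight_apply, AlgHom.toLinearMap_apply, bWedge,
    ExteriorAlgebra.map_apply_ιMulti, bWedge, ExteriorAlgebra.ιMulti_mul_ιMulti, bWedge]
  congr 1
  ext1 i
  refine Fin.addCases (fun i => ?_) (fun i => ?_) i
  · rw [Fin.append_left, Function.comp_apply, up_pow_b]
    have h : (i : ℕ) < r := i.2
    have h2 : (if h : ((Fin.castAdd k i : Fin (r + k)) : ℕ) < r then l ⟨_, h⟩ else 0) = l i :=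
      dif_pos h
    simp only [idx]
    rw [h2, Fin.val_castAdd]
    congr 1
    omega
  · rw [Fin.append_right]
    simp only [idx, Fin.val_natAdd, add_lt_iff_neg_left, not_lt_zero, dif_neg, not_false_iff,
      Pi.zero_apply]
    congr 1
    omega

lemma hsCoeff_eventually_zero (f : ℕ → Module.End ℚ V) (hf : ∀ v, ∃ N, ∀ n ≥ N, f n v = 0)
    (u : ExtV) : ∃ N, ∀ n ≥ N, hsCoeff f n u = 0 := by
  change ∃ N, ∀ n ≥ N, PowerSeries.coeff n (hsDer f u) = 0
  induction u using ExteriorAlgebra.induction with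
  | algebraMap q =>
    refine ⟨1, fun n hn => ?_⟩
    rw [AlgHom.commutes, PowerSeries.algebraMap_apply, PowerSeries.coeff_C, if_neg (by omega)]
  | ι v =>
    obtain ⟨N, hN⟩ := hf v
    refine ⟨N, fun n hn => ?_⟩
    rw [hsDer, ExteriorAlgebra.lift_ι_apply]
    simp [hsOnV, hN n hn]
  | mul u v hu hv =>
    obtain ⟨N, hN⟩ := hu
    obtain ⟨M, hM⟩ := hv
    refine ⟨N + M, fun n hn => ?_⟩
    rw [map_mul, PowerSeries.coeff_mul]
    refine Finset.sum_eq_zero fun p hp => ?_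
    have := Finset.HasAntidiagonal.mem_antidiagonal.1 hp
    rcases le_or_gt N p.1 with h | h
    · rw [hN _ h, zero_mul]
    · rw [hM p.2 (by omega), mul_zero]
  | add u v hu hv =>
    obtain ⟨N, hN⟩ := hu
    obtain ⟨M, hM⟩ := hv
    refine ⟨N + M, fun n hn => ?_⟩
    rw [map_add, map_add, hN n (by omega), hM n (by omega), add_zero]

lemma sigmaBarMinus_finite (u : ExtV) : {n : ℤ | sigmaBarMinus n u ≠ 0}.Finite := by
  obtain ⟨N, hN⟩ := hsCoeff_eventually_zero (geoInv down)
    (fun v => ⟨2, fun n hn => by simp [geoInv, show n ≠ 0 by omega, show n ≠ 1 by omega]⟩) u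
  refine (Set.finite_Icc (-(N : ℤ)) 0).subset fun n hn => ?_
  simp only [Set.mem_ofPred_eq, sigmaBarMinus] at hn
  split_ifs at hn with h
  · refine ⟨?_, h⟩
    by_contra h'
    exact hn (hN _ (by omega))
  · exact absurd rfl hn

lemma multi_finite {D : ℤ → Module.End ℚ ExtV} (hD : ∀ u, {n : ℤ | D n u ≠ 0}.Finite) (k : ℕ)
    (u : ExtV) : {q : Fin k → ℤ | multi D q u ≠ 0}.Finite := by
  induction k with
  | zero => exact Set.toFinite _
  | succ k ih =>
    have h1 : (⋃ t ∈ {q : Fin k → ℤ | multi D q u ≠ 0},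
        (fun n : ℤ => (Fin.cons n t : Fin (k + 1) → ℤ)) '' {n : ℤ | D n (multi D t u) ≠ 0}).Finite :=
      ih.biUnion fun t _ => (hD _).image _
    refine h1.subset fun q hq => ?_
    have hq' : D (q 0) (multi D (fun i => q i.succ) u) ≠ 0 := by
      have : multi D q u = D (q 0) (multi D (fun i => q i.succ) u) := by
        simp [multi, List.ofFn_succ]
      rw [← this]
      exact hq
    have hq2 : multi D (fun i => q i.succ) u ≠ 0 := fun h => hq' (by rw [h, map_zero])
    refine Set.mem_biUnion (x := fun i => q i.succ) (by simpa using hq2) ?_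
    exact (Set.mem_image _ _ _).2 ⟨q 0, by simpa using hq', Fin.cons_self_tail q⟩

lemma Gamma_support_finite (k : ℕ) (a : Fin k → ℤ) (u : ExtV) :
    (Function.support fun q : Fin k → ℤ =>
      multi sigmaPlus (a - q) (multi sigmaBarMinus q u)).Finite := by
  refine (multi_finite sigmaBarMinus_finite k u).subset fun q hq h => hq ?_
  simp only [h, map_zero]

/-- The vertex operator `Γ(z_k)`, `Γ(z_k) [b]^r_λ = σ₊(z_k) σ̄₋(z_k) [b]^{r+k}_λ`: the coefficient
of `z^a`. By `Gamma_support_finite` the sum is finite. -/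
def Gamma (k : ℕ) (a : Fin k → ℤ) (u : ExtV) : ExtV :=
  ∑ᶠ q : Fin k → ℤ, multi sigmaPlus (a - q) (multi sigmaBarMinus q (raise k u))

/-- For a sequence `H`, the sequence `σ₋(w) H` with `x = w⁻¹`: `(σ₋(w) H)_n = ∑_{i ≥ 0} H_{n-i} x^i`.
It is applied to sequences that vanish at negative indices, where the sum ends at `i = n`. -/
def minusSeq {R : Type*} [CommRing R] (x : R) (H : ℤ → R) (n : ℤ) : R :=
  ∑ i ∈ Finset.range (n.toNat + 1), H (n - (i : ℤ)) * x ^ i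

/-- The sequence `σ₋(w_k) H_m = σ₋(w_1) ⋯ σ₋(w_k) H_m` in `B_m[w_1⁻¹, ..., w_k⁻¹]`; the variable
`w_j⁻¹` is `MvPolynomial.X j`. -/
def minusH (k m : ℕ) : ℤ → MvPolynomial (Fin k) (B m) :=
  (List.ofFn fun j : Fin k => minusSeq (MvPolynomial.X j : MvPolynomial (Fin k) (B m))).foldr
    (fun T H => T H) fun n => MvPolynomial.C (hSeq m n)

/-- For `P ∈ B_m[w_1⁻¹, ..., w_k⁻¹]`, the coefficient of `w^c` in `σ̄₊(w_k) (P [b]^m_0)`. -/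
def barPlusCoeff (k m : ℕ) (c : Fin k → ℤ) : MvPolynomial (Fin k) (B m) →ₗ[ℚ] ExtV :=
  (Finsupp.lsum ℚ fun s : Fin k →₀ ℕ =>
      (multi sigmaBarPlus fun j => c j + (s j : ℤ)) ∘ₗ toWedge m) ∘ₗ
    (AddMonoidAlgebra.coeffLinearEquiv ℚ).toLinearMap

/-- The vertex operator `Γ*(w_k)`,
`Γ*(w_k) [b]^r_λ = (σ̄₊(w_k) Δ_λ(σ₋(w_k) H_{r-k})) [b]^{r-k}_0`, and `0` on `⋀^r V` for `r < k`: the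
coefficient of `w^c`. -/
def GammaStar (k : ℕ) (c : Fin k → ℤ) : Module.End ℚ ExtV :=
  ExteriorAlgebra.liftAlternating fun r =>
    if k ≤ r then (barPlusCoeff k (r - k) c).compAlternatingMap (schurAlt (minusH k (r - k)) r)
    else 0

lemma GammaStar_bWedge (k : ℕ) (c : Fin k → ℤ) {r : ℕ} (h : k ≤ r) (l : Fin r → ℕ) :
    GammaStar k c (bWedge l) = barPlusCoeff k (r - k) c (schurDet (minusH k (r - k)) l) := by
  rw [GammaStar, bWedge, ExteriorAlgebra.liftAlternating_apply_ιMulti, if_pos h,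
    LinearMap.compAlternatingMap_apply, schurAlt_apply]

end ExtVertex

end

noncomputable section

namespace ExtVertex

open ExteriorAlgebra

/-! After transport to ⋀^r V, the generating function sends [b]^r_λ to (∑ s_μ(z) [b]^k_μ) ∧ (∑
s_ν(w⁻¹) [β]^k_ν ⌟ [b]^r_λ) (`toWedge_genAct`). Up to the powers of z_j and w_j, Γ produces the
first factor and Γ* the second.

The wedge factor. Since b_{j+1} - b_j z⁻¹ = -z⁻¹ (b_j - b_{j+1} z), σ̄₋(z) acts on a shifted vector
of degree d as (-z)^{-d} σ̄₊(z), while it fixes [b]^k_0. As σ₊ is multiplicative and inverse to σ̄₊,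
this gives Γ(z) u = ∏ z_j^{-d} · σ₊(z)[b]^k_0 ∧ u (`Gamma_eq`). On ⋀^k V, σ₊(z) is multiplication by
1/E_k(z), so the Cauchy identity expands σ₊(z)[b]^k_0 in Schur polynomials
(`multi_sigmaPlus_bWedge_zero`).

The contraction factor. With x = w⁻¹, σ₋(w) divides the generating series of H by 1 - x t. If H
inverts f = f_0 + ⋯ + f_m t^m, multiply the determinant of σ₋(w)H by a companion matrix of
determinant x^m f(1/x): one row becomes powers of x, the others contain entries of H. Expansion
along that row is ∑ x^n β_n ⌟. Over k variables the companion determinants multiply to ∏_{i<j} (x_i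
- x_j) · ∏ x_j^m E_m(1/x_j), and the second product is the action of σ̄₊(w) up to ∏ w_j^m
(`IsInverseSeq.prod_mul_schurLin_minusIter`, `GammaStar_bWedge_eq`).

Both Schur expansions come from one principle: the generating series of an alternating function of
exponents is the Vandermonde product times a series in Schur polynomials, and the Vandermonde
product can be cancelled (`coeff_eq_finsum_schur`).

The identification of B_r with ⋀^r V rests on the linear recurrence of the h_n, by which 1 - t σ_1
multiplies Schur determinants by E_r(t) (`ofWedge_sigmaBarPlus`); surjectivity follows by lowering
indices (`ιMulti_b_mem_range`). The statement on σ₋ reduces to h_n [b]^r_0 = b_{r-1+n} ∧ b_{r-2} ∧ ⋯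
∧ b_0. -/

lemma ext_left_induction {P : ExtV → Prop} (one : P 1) (add : ∀ u v, P u → P v → P (u + v))
    (smul : ∀ (c : ℚ) u, P u → P (c • u)) (ι_mul : ∀ v u, P u → P (ι ℚ v * u)) (u : ExtV) : P u := by
  induction u using CliffordAlgebra.left_induction with
  | algebraMap q => rw [Algebra.algebraMap_eq_smul_one]; exact smul _ _ one
  | add u v hu hv => exact add _ _ hu hv
  | ι_mul u v hu => exact ι_mul _ _ hu

/-! ### Recurrences for the coefficients of Schubert derivations -/

/-- The coefficient of `z^n`, `n : ℤ`, in `hsDer f`. -/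
def hsZ (f : ℕ → Module.End ℚ V) (n : ℤ) : Module.End ℚ ExtV :=
  if 0 ≤ n then hsCoeff f n.toNat else 0

lemma hsZ_natCast (f : ℕ → Module.End ℚ V) (n : ℕ) : hsZ f n = hsCoeff f n := by simp [hsZ]

lemma hsZ_of_neg (f : ℕ → Module.End ℚ V) {n : ℤ} (h : n < 0) : hsZ f n = 0 := by
  simp [hsZ, not_le.2 h]

lemma hsZ_one (f : ℕ → Module.End ℚ V) (n : ℤ) : hsZ f n 1 = if n = 0 then 1 else 0 := by
  rcases lt_or_ge n 0 with h | h
  · rw [hsZ_of_neg f h, if_neg h.ne]; rfl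
  · lift n to ℕ using h
    rw [hsZ_natCast]
    simp [hsCoeff, PowerSeries.coeff_one]

/-- The Horner form of the geometric series; it turns multiplicativity of the derivation into a
two-term recurrence. -/
lemma hsOnV_geo (φ : Module.End ℚ V) (v : V) :
    hsOnV (geo φ) v = PowerSeries.C (ι ℚ v) + PowerSeries.X * hsOnV (geo φ) (φ v) := by
  ext n
  rcases n with _ | n
  · simp [hsOnV, geo]
  · rw [map_add, PowerSeries.coeff_succ_X_mul]
    simp [hsOnV, geo, pow_succ]

lemma hsOnV_geoInv (φ : Module.End ℚ V) (v : V) :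
    hsOnV (geoInv φ) v = PowerSeries.C (ι ℚ v) - PowerSeries.X * PowerSeries.C (ι ℚ (φ v)) := by
  ext n
  rcases n with _ | n
  · simp [hsOnV, geoInv]
  · rw [map_sub, PowerSeries.coeff_succ_X_mul]
    rcases n with _ | n
    all_goals simp [hsOnV, geoInv, PowerSeries.coeff_C]

lemma hsDer_ι_mul (f : ℕ → Module.End ℚ V) (v : V) (u : ExtV) :
    hsDer f (ι ℚ v * u) = hsOnV f v * hsDer f u := by
  rw [map_mul]
  congr 1
  exact ExteriorAlgebra.lift_ι_apply ℚ _ _ v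

/-- The last term has lower degree but a product of the same length, so inductions that use it run
on n as well as on the vector. -/
lemma hsZ_geo_ι_mul (φ : Module.End ℚ V) (n : ℤ) (v : V) (u : ExtV) :
    hsZ (geo φ) n (ι ℚ v * u) =
      ι ℚ v * hsZ (geo φ) n u + hsZ (geo φ) (n - 1) (ι ℚ (φ v) * u) := by
  rcases lt_or_ge n 0 with h | h
  · rw [hsZ_of_neg _ h, hsZ_of_neg _ (by omega : n - 1 < 0)]; simp
  · lift n to ℕ using h
    rw [hsZ_natCast]
    rcases n with _ | n
    · rw [hsZ_of_neg _ (by simp)]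
      simp [hsCoeff, hsDer_ι_mul, hsOnV, geo]
    · rw [show ((n + 1 : ℕ) : ℤ) - 1 = (n : ℤ) by simp, hsZ_natCast]
      simp only [hsCoeff, LinearMap.coe_mk, AddHom.coe_mk, hsDer_ι_mul]
      rw [hsOnV_geo, add_mul, mul_assoc, map_add, PowerSeries.coeff_succ_X_mul,
        PowerSeries.coeff_C_mul]

lemma hsZ_geoInv_ι_mul (φ : Module.End ℚ V) (n : ℤ) (v : V) (u : ExtV) :
    hsZ (geoInv φ) n (ι ℚ v * u) =
      ι ℚ v * hsZ (geoInv φ) n u - ι ℚ (φ v) * hsZ (geoInv φ) (n - 1) u := by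
  rcases lt_or_ge n 0 with h | h
  · rw [hsZ_of_neg _ h, hsZ_of_neg _ (by omega : n - 1 < 0)]; simp
  · lift n to ℕ using h
    rw [hsZ_natCast]
    rcases n with _ | n
    · rw [hsZ_of_neg _ (by simp)]
      simp [hsCoeff, hsDer_ι_mul, hsOnV, geoInv]
    · rw [show ((n + 1 : ℕ) : ℤ) - 1 = (n : ℤ) by simp, hsZ_natCast]
      simp only [hsCoeff, LinearMap.coe_mk, AddHom.coe_mk, hsDer_ι_mul]
      rw [hsOnV_geoInv, sub_mul, mul_assoc, map_sub, PowerSeries.coeff_succ_X_mul,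
        PowerSeries.coeff_C_mul, PowerSeries.coeff_C_mul]

lemma sigmaMinus_eq (n : ℤ) : sigmaMinus n = hsZ (geo down) (-n) := by
  simp [sigmaMinus, hsZ]

lemma sigmaBarMinus_eq (n : ℤ) : sigmaBarMinus n = hsZ (geoInv down) (-n) := by
  simp [sigmaBarMinus, hsZ]

lemma sigmaPlus_ι_mul (n : ℤ) (v : V) (u : ExtV) : sigmaPlus n (ι ℚ v * u) =
    ι ℚ v * sigmaPlus n u + sigmaPlus (n - 1) (ι ℚ (up v) * u) := hsZ_geo_ι_mul _ _ _ _

lemma sigmaBarPlus_ι_mul (n : ℤ) (v : V) (u : ExtV) : sigmaBarPlus n (ι ℚ v * u) =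
    ι ℚ v * sigmaBarPlus n u - ι ℚ (up v) * sigmaBarPlus (n - 1) u := hsZ_geoInv_ι_mul _ _ _ _

lemma sigmaBarMinus_ι_mul (n : ℤ) (v : V) (u : ExtV) : sigmaBarMinus n (ι ℚ v * u) =
    ι ℚ v * sigmaBarMinus n u - ι ℚ (down v) * sigmaBarMinus (n + 1) u := by
  rw [sigmaBarMinus_eq, hsZ_geoInv_ι_mul, sigmaBarMinus_eq, neg_add, sub_eq_add_neg (-n)]

lemma sigmaPlus_one (n : ℤ) : sigmaPlus n 1 = if n = 0 then 1 else 0 := hsZ_one _ _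

lemma sigmaBarPlus_one (n : ℤ) : sigmaBarPlus n 1 = if n = 0 then 1 else 0 := hsZ_one _ _

lemma sigmaBarMinus_one (n : ℤ) : sigmaBarMinus n 1 = if n = 0 then 1 else 0 := by
  rw [sigmaBarMinus_eq, hsZ_one]; simp

lemma sigmaPlus_of_neg {n : ℤ} (h : n < 0) : sigmaPlus n = 0 := hsZ_of_neg _ h

lemma sigmaBarPlus_of_neg {n : ℤ} (h : n < 0) : sigmaBarPlus n = 0 := hsZ_of_neg _ h

lemma up_b (n : ℕ) : up (b n) = b (n + 1) := by
  rw [up, b, Finsupp.linearCombination_single, one_smul]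

lemma down_b_succ (n : ℕ) : down (b (n + 1)) = b n := by
  rw [down, b, Finsupp.linearCombination_single, one_smul]; simp

lemma down_b_zero : down (b 0) = 0 := by
  rw [down, b, Finsupp.linearCombination_single, one_smul]; simp

lemma linearMap_V_ext {M : Type*} [AddCommMonoid M] [Module ℚ M] {f g : V →ₗ[ℚ] M}
    (h : ∀ n, f (b n) = g (b n)) : f = g :=
  Finsupp.lhom_ext' fun n => LinearMap.ext_ring (h n)

/-- Only this composite is the identity, because `down` kills b_0. -/
lemma down_up (v : V) : down (up v) = v := by
  have : down ∘ₗ up = LinearMap.id := linearMap_V_ext fun n => by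
    rw [LinearMap.comp_apply, up_b, down_b_succ]; rfl
  exact LinearMap.congr_fun this v

lemma sigmaBarPlus_comm (m n : ℤ) (u : ExtV) :
    sigmaBarPlus m (sigmaBarPlus n u) = sigmaBarPlus n (sigmaBarPlus m u) := by
  induction u using ext_left_induction generalizing m n with
  | one => simp only [sigmaBarPlus_one]; split_ifs <;> simp [sigmaBarPlus_one, *]
  | add u v hu hv => simp only [map_add, hu m, hv m]
  | smul c u hu => simp only [map_smul, hu m]
  | ι_mul v u hu =>
    simp only [sigmaBarPlus_ι_mul, map_sub]
    rw [hu m n, hu (m - 1) n, hu m (n - 1), hu (m - 1) (n - 1)]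
    abel

lemma sigmaPlus_comm_sigmaBarPlus (m n : ℤ) (u : ExtV) :
    sigmaPlus m (sigmaBarPlus n u) = sigmaBarPlus n (sigmaPlus m u) := by
  rcases lt_or_ge m 0 with h | h
  · simp [sigmaPlus_of_neg h]
  lift m to ℕ using h
  induction m using Nat.strong_induction_on generalizing n u with
  | _ m ihm =>
  -- Degree m - 1 is needed at `ι (up v) * u`, which the inner induction on u does not reach; hence
  -- the outer induction on m.
  have ih' (n : ℤ) (u : ExtV) : sigmaPlus ((m : ℤ) - 1) (sigmaBarPlus n u) =
      sigmaBarPlus n (sigmaPlus ((m : ℤ) - 1) u) := by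
    rcases m with _ | m
    · simp [sigmaPlus_of_neg]
    · have := ihm m (by omega) n u
      simpa using this
  induction u using ext_left_induction generalizing n with
  | one =>
    simp only [sigmaBarPlus_one, sigmaPlus_one]
    split_ifs with h1 h2 h2 <;>
      simp only [sigmaBarPlus_one, sigmaPlus_one, h1, h2, map_zero, if_true, if_false]
  | add u v hu hv => simp only [map_add, hu n, hv n]
  | smul c u hu => simp only [map_smul, hu n]
  | ι_mul v u hu =>
    rw [sigmaBarPlus_ι_mul, map_sub, sigmaPlus_ι_mul _ v, sigmaPlus_ι_mul _ (up v) (sigmaBarPlus (n - 1) u),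
      sigmaPlus_ι_mul _ v u, map_add, sigmaBarPlus_ι_mul, ← ih', sigmaBarPlus_ι_mul, map_sub, hu n,
      hu (n - 1)]
    abel

/-! ### The exterior powers -/

lemma ι_mul_mem {d : ℕ} (v : V) {u : ExtV} (hu : u ∈ ⋀[ℚ]^d V) : ι ℚ v * u ∈ ⋀[ℚ]^(d + 1) V := by
  rw [exteriorPower, pow_succ']
  exact Submodule.mul_mem_mul ⟨v, rfl⟩ hu

lemma exteriorPower_induction {P : (d : ℕ) → ExtV → Prop} (one : P 0 1)
    (zero : ∀ d, P d 0) (add : ∀ d u v, P d u → P d v → P d (u + v))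
    (smul : ∀ d (c : ℚ) u, P d u → P d (c • u))
    (ι_mul : ∀ d v u, u ∈ ⋀[ℚ]^d V → P d u → P (d + 1) (ι ℚ v * u)) {d : ℕ} {u : ExtV}
    (hu : u ∈ ⋀[ℚ]^d V) : P d u := by
  rw [← ιMulti_span_fixedDegree] at hu
  induction hu using Submodule.span_induction with
  | zero => exact zero d
  | add u v _ _ hu hv => exact add d u v hu hv
  | smul c u _ hu => exact smul d c u hu
  | mem u hu =>
    obtain ⟨w, rfl⟩ := hu
    induction d with
    | zero => rw [ιMulti_zero_apply]; exact one
    | succ d ih =>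
      rw [ιMulti_succ_apply]
      exact ι_mul d _ _ (ιMulti_range ℚ d ⟨_, rfl⟩) (ih _)

lemma ιMulti_mem {d : ℕ} (w : Fin d → V) : ιMulti ℚ d w ∈ ⋀[ℚ]^d V := ιMulti_range ℚ d ⟨_, rfl⟩

lemma bWedge_mem {r : ℕ} (l : Fin r → ℕ) : bWedge l ∈ ⋀[ℚ]^r V := ιMulti_mem _

lemma mul_mem_exteriorPower {c d : ℕ} {u v : ExtV} (hu : u ∈ ⋀[ℚ]^c V) (hv : v ∈ ⋀[ℚ]^d V) :
    u * v ∈ ⋀[ℚ]^(c + d) V := by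
  rw [exteriorPower, pow_add]
  exact Submodule.mul_mem_mul hu hv

lemma sigmaBarPlus_mem {d : ℕ} {u : ExtV} (hu : u ∈ ⋀[ℚ]^d V) (n : ℤ) :
    sigmaBarPlus n u ∈ ⋀[ℚ]^d V := by
  refine exteriorPower_induction (P := fun d u => ∀ n, sigmaBarPlus n u ∈ ⋀[ℚ]^d V)
    (fun n => ?_) (by simp) (fun d u v hu hv n => ?_) (fun d c u hu n => ?_)
    (fun d v u _ hu n => ?_) hu n
  · rw [sigmaBarPlus_one]
    split_ifs
    · exact ⟨1, by simp⟩
    · exact zero_mem _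
  · rw [map_add]; exact add_mem (hu n) (hv n)
  · rw [map_smul]; exact Submodule.smul_mem _ _ (hu n)
  · rw [sigmaBarPlus_ι_mul]
    exact sub_mem (ι_mul_mem _ (hu _)) (ι_mul_mem _ (hu _))

lemma sigmaPlus_mem {d : ℕ} {u : ExtV} (hu : u ∈ ⋀[ℚ]^d V) (n : ℤ) :
    sigmaPlus n u ∈ ⋀[ℚ]^d V := by
  rcases lt_or_ge n 0 with h | h
  · simp [sigmaPlus_of_neg h]
  lift n to ℕ using h
  refine exteriorPower_induction (P := fun d u => ∀ n : ℕ, sigmaPlus n u ∈ ⋀[ℚ]^d V)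
    (fun n => ?_) (by simp) (fun d u v hu hv n => ?_) (fun d c u hu n => ?_)
    (fun d v u _ hu n => ?_) hu n
  · rw [sigmaPlus_one]
    split_ifs
    · exact ⟨1, by simp⟩
    · exact zero_mem _
  · rw [map_add]; exact add_mem (hu n) (hv n)
  · rw [map_smul]; exact Submodule.smul_mem _ _ (hu n)
  · induction n generalizing v with
    | zero =>
      rw [sigmaPlus_ι_mul, sigmaPlus_of_neg (n := ((0 : ℕ) : ℤ) - 1) (by simp)]
      simpa using ι_mul_mem v (hu 0)
    | succ n ih =>
      rw [sigmaPlus_ι_mul]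
      refine add_mem (ι_mul_mem _ (hu _)) ?_
      simpa using ih (up v)

/-- Each of the d factors contributes degree at most 1 in z. -/
lemma sigmaBarPlus_eq_zero {d : ℕ} {u : ExtV} (hu : u ∈ ⋀[ℚ]^d V) {n : ℤ} (hn : (d : ℤ) < n) :
    sigmaBarPlus n u = 0 := by
  refine exteriorPower_induction (P := fun d u => ∀ n : ℤ, (d : ℤ) < n → sigmaBarPlus n u = 0)
    (fun n hn => ?_) (by simp) (fun d u v hu hv n hn => ?_) (fun d c u hu n hn => ?_)
    (fun d v u _ hu n hn => ?_) hu n hn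
  · rw [sigmaBarPlus_one, if_neg (by simp at hn; omega)]
  · rw [map_add, hu n hn, hv n hn, add_zero]
  · rw [map_smul, hu n hn, smul_zero]
  · push_cast at hn
    rw [sigmaBarPlus_ι_mul, hu n (by omega), hu (n - 1) (by omega), mul_zero, mul_zero, sub_zero]

lemma mul_graded_comm {c d : ℕ} {u v : ExtV} (hu : u ∈ ⋀[ℚ]^c V) (hv : v ∈ ⋀[ℚ]^d V) :
    u * v = (-1 : ℚ) ^ (c * d) • (v * u) := by
  have key (x : V) {d : ℕ} {v : ExtV} (hv : v ∈ ⋀[ℚ]^d V) :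
      ι ℚ x * v = (-1 : ℚ) ^ d • (v * ι ℚ x) := by
    refine exteriorPower_induction
      (P := fun d v => ι ℚ x * v = (-1 : ℚ) ^ d • (v * ι ℚ x)) (by simp) (by simp)
      (fun d u v hu hv => ?_) (fun d c u hu => ?_) (fun d v u _ hu => ?_) hv
    · rw [mul_add, hu, hv, add_mul, smul_add]
    · rw [mul_smul_comm, hu, smul_mul_assoc, smul_comm]
    · rw [← mul_assoc, eq_neg_of_add_eq_zero_left (ι_add_mul_swap x v), neg_mul, mul_assoc, hu,
        pow_succ, mul_smul_comm, mul_assoc, mul_neg_one, neg_smul]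
  refine exteriorPower_induction
    (P := fun c u => u * v = (-1 : ℚ) ^ (c * d) • (v * u)) (by simp) (by simp)
      (fun d u v hu hv => ?_) (fun d c u hu => ?_) (fun c x u _ hu => ?_) hu
  · rw [mul_add, add_mul, hu, hv, smul_add]
  · rw [mul_smul_comm, smul_mul_assoc, hu, smul_comm]
  · rw [mul_assoc, hu, mul_smul_comm, ← mul_assoc, key x hv, smul_mul_assoc, smul_smul, mul_assoc,
      ← pow_add, add_mul, one_mul]

/-! ### Determinants of companion type -/

lemma det_companion {R : Type*} [CommRing R] {n : ℕ} (g : Fin (n + 1) → R) (x : R) :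
    Matrix.det (Matrix.of fun i j : Fin (n + 1) => Fin.cases (motive := fun _ => R) (g j)
      (fun i' => (if j = i'.succ then 1 else 0) - (if j = i'.castSucc then x else 0)) i) =
      ∑ j, g j * x ^ (j : ℕ) := by
  set T := Matrix.of fun i j : Fin (n + 1) => Fin.cases (motive := fun _ => R) (g j)
      (fun i' => (if j = i'.succ then 1 else 0) - (if j = i'.castSucc then x else 0)) i with hT
  -- The identity matrix with first column (1, x, …, x^n). That column is annihilated by every row
  -- of `T` except the first, so `T * L` has a single nonzero entry in column 0, with a
  -- unitriangular minor.
  let L : Matrix (Fin (n + 1)) (Fin (n + 1)) R := Matrix.of fun i j =>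
    Fin.cases (motive := fun _ => R) (x ^ (i : ℕ)) (fun j' => if i = j'.succ then 1 else 0) j
  have hL : L.det = 1 := by
    rw [Matrix.det_of_isLowerTriangular]
    · refine Finset.prod_eq_one fun i _ => ?_
      refine Fin.cases ?_ (fun i => ?_) i <;> simp [L]
    · intro i j hij
      have hij : i < j := hij
      obtain ⟨j', rfl⟩ := Fin.exists_succ_eq.2 (Fin.ne_zero_of_lt hij)
      simp [L, hij.ne]
  have hzero : ∀ i, (T * L) i 0 = if i = 0 then ∑ j, g j * x ^ (j : ℕ) else 0 := by
    intro i
    rw [Matrix.mul_apply]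
    refine Fin.cases ?_ (fun i => ?_) i
    · simp [T, L]
    · simp [T, L, sub_mul, Finset.sum_sub_distrib, Fin.succ_ne_zero, pow_succ']
  have hsucc : ∀ i (j : Fin n), (T * L) i j.succ = T i j.succ := by
    intro i j
    rw [Matrix.mul_apply]
    simp [L]
  rw [← mul_one T.det, ← hL, ← Matrix.det_mul, Matrix.det_succ_column_zero,
    Finset.sum_eq_single 0]
  · rw [hzero, if_pos rfl]
    have : ((T * L).submatrix (Fin.succAbove 0) Fin.succ).det = 1 := by
      rw [Matrix.det_of_isLowerTriangular]
      · refine Finset.prod_eq_one fun i _ => ?_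
        rw [Matrix.submatrix_apply, hsucc]
        simp [T, Fin.ext_iff]
      · intro i j hij
        have hij : i < j := hij
        rw [Matrix.submatrix_apply, hsucc]
        have h1 : ¬ (j = i) := hij.ne'
        have h2 : ¬ ((j : ℕ) + 1 = i) := by have := Fin.lt_def.1 hij; omega
        simp [T, Fin.ext_iff, h2, Fin.val_ne_of_ne h1]
    rw [this]; simp
  · intro i _ hi
    rw [hzero, if_neg hi]; simp
  · simp

/-- `H` vanishes at negative indices and `(f_0 + f_1 t + ⋯ + f_m t^m) (∑ H_n t^n) = 1`. -/
structure IsInverseSeq {R : Type*} [CommRing R] (m : ℕ) (f : ℕ → R) (H : ℤ → R) : Prop where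
  coeff_zero : f 0 = 1
  of_neg : ∀ n < 0, H n = 0
  sum_eq : ∀ n : ℤ, ∑ i ∈ Finset.range (m + 1), f i * H (n - i) = if n = 0 then 1 else 0

lemma IsInverseSeq.zero {R : Type*} [CommRing R] {m : ℕ} {f : ℕ → R} {H : ℤ → R}
    (h : IsInverseSeq m f H) : H 0 = 1 := by
  have := h.sum_eq 0
  rw [Finset.sum_range_succ', Finset.sum_eq_zero] at this
  · simpa [h.coeff_zero] using this
  · intro i _
    rw [h.of_neg _ (by push_cast; omega), mul_zero]

/-- The coefficient of `z^n`, `n : ℤ`, in `E_r(z)`. -/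
def eps (r : ℕ) (n : ℤ) : B r := if 0 ≤ n then (-1) ^ n.toNat * e r n.toNat else 0

lemma eps_natCast (r n : ℕ) : eps r n = (-1) ^ n * e r n := by simp [eps]

lemma eps_zero (r : ℕ) : eps r 0 = 1 := by simp [eps, e]

lemma eps_of_neg {r : ℕ} {n : ℤ} (h : n < 0) : eps r n = 0 := by simp [eps, not_le.2 h]

lemma eps_of_gt {r : ℕ} {n : ℤ} (h : (r : ℤ) < n) : eps r n = 0 := by
  lift n to ℕ using by omega
  rw [eps_natCast, e, if_neg (by omega), dif_neg (by omega), mul_zero]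

lemma hSeq_of_neg {r : ℕ} {n : ℤ} (h : n < 0) : hSeq r n = 0 := by simp [hSeq, not_le.2 h]

lemma isInverseSeq_hSeq (r : ℕ) : IsInverseSeq r (fun i => eps r i) (hSeq r) where
  coeff_zero := eps_zero r
  of_neg n h := hSeq_of_neg h
  sum_eq n := by
    rcases lt_or_ge n 0 with h | h
    · rw [if_neg h.ne]
      exact Finset.sum_eq_zero fun i _ => by rw [hSeq_of_neg (by omega), mul_zero]
    lift n to ℕ using h
    have h1 := congrArg (PowerSeries.coeff n) (Epoly_mul_inv r)
    rw [PowerSeries.coeff_mul, PowerSeries.coeff_one,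
      Finset.Nat.sum_antidiagonal_eq_sum_range_succ_mk] at h1
    have h2 : ∑ i ∈ Finset.range (n + 1), eps r i * hSeq r ((n : ℤ) - i) =
        ∑ i ∈ Finset.range (r + n + 1), eps r i * hSeq r ((n : ℤ) - i) :=
      Finset.sum_subset (by intro i; simp; omega) fun i _ hi => by
        rw [hSeq_of_neg (by simp at hi; omega), mul_zero]
    have h3 : ∑ i ∈ Finset.range (r + 1), eps r i * hSeq r ((n : ℤ) - i) =
        ∑ i ∈ Finset.range (r + n + 1), eps r i * hSeq r ((n : ℤ) - i) :=
      Finset.sum_subset (by intro i; simp; omega) fun i _ hi => by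
        rw [eps_of_gt (by simp at hi; omega), zero_mul]
    rw [h3, ← h2]
    simp only [Nat.cast_eq_zero]
    rw [← h1]
    refine Finset.sum_congr rfl fun i hi => ?_
    have : i ≤ n := by simpa [Nat.lt_succ_iff] using hi
    rw [eps_natCast, ← Nat.cast_sub this]
    simp [Epoly, hSeq]

/-! ### Determinants of inverse sequences -/

/-- The matrix of the multiplication by `1 - t σ_1` in the coordinates of `rowVec`. -/
def upMatrix {R : Type*} [CommRing R] (r : ℕ) (f : ℕ → R) (t : R) : Matrix (Fin r) (Fin r) R :=
  Matrix.of fun i j => (if j = i then 1 else 0) -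
    t * (if (i : ℕ) + 1 < r then (if (j : ℕ) = i + 1 then 1 else 0) else - f (r - j))

lemma det_upMatrix {R : Type*} [CommRing R] (r : ℕ) (f : ℕ → R) (hf : f 0 = 1) (t : R) :
    (upMatrix r f t).det = ∑ i ∈ Finset.range (r + 1), f i * t ^ i := by
  rcases r with _ | r
  · simp [hf]
  rw [← Matrix.det_submatrix_equiv_self Fin.revPerm (upMatrix (r + 1) f t)]
  -- Reversing rows and columns together preserves the determinant and puts the recurrence row
  -- first; δ_{j0} in the top row is the diagonal entry of that row.
  have := det_companion (n := r)
    (fun j => (if j = 0 then 1 else 0) + t * f ((j : ℕ) + 1)) t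
  rw [Finset.sum_range_succ', ← Fin.sum_univ_eq_sum_range fun i => f (i + 1) * t ^ (i + 1)]
  convert this using 2
  · ext i j
    have hj := j.2
    refine Fin.cases ?_ (fun i => ?_) i
    · have h1 : ¬ ((Fin.rev (0 : Fin (r + 1)) : ℕ) + 1 < r + 1) := by simp
      have h2 : r + 1 - (Fin.rev j : ℕ) = j + 1 := by rw [Fin.val_rev]; omega
      simp only [Matrix.submatrix_apply, Fin.revPerm_apply, upMatrix, Matrix.of_apply, Fin.rev_inj,
        Fin.cases_zero, h1, if_false, h2, mul_neg, sub_neg_eq_add]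
    · have hi := i.2
      have h1 : ((Fin.rev i.succ : Fin (r + 1)) : ℕ) + 1 < r + 1 := by simp [Fin.val_rev]; omega
      have h2 : ((Fin.rev j : ℕ) = (Fin.rev i.succ : Fin (r + 1)) + 1) ↔ j = i.castSucc := by
        rw [Fin.ext_iff, Fin.val_castSucc, Fin.val_rev, Fin.val_rev, Fin.val_succ]
        omega
      simp only [Matrix.submatrix_apply, Fin.revPerm_apply, upMatrix, Matrix.of_apply, Fin.rev_inj,
        Fin.cases_succ, h1, if_true, h2, mul_ite, mul_one, mul_zero]
  · simp only [add_mul, Finset.sum_add_distrib, hf, pow_zero, mul_one, ite_mul, one_mul, zero_mul]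
    rw [add_comm]
    congr 1
    · simp
    · exact Finset.sum_congr rfl fun i _ => by ring

section SchurAlt

variable {R : Type*} [CommRing R] [Algebra ℚ R]

/-- The vector `(H_{n-r+1}, ..., H_n)` attached to `b_n`, extended linearly. -/
def rowVec (H : ℤ → R) (r : ℕ) : V →ₗ[ℚ] (Fin r → R) :=
  Finsupp.linearCombination ℚ fun (n : ℕ) (i : Fin r) => H ((n : ℤ) - (r : ℤ) + 1 + (i : ℤ))

lemma rowVec_b (H : ℤ → R) (r n : ℕ) (i : Fin r) :
    rowVec H r (b n) i = H ((n : ℤ) - (r : ℤ) + 1 + (i : ℤ)) := by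
  rw [rowVec, b, Finsupp.linearCombination_single, one_smul]

lemma schurAlt_eq_det (H : ℤ → R) (r : ℕ) (w : Fin r → V) :
    schurAlt H r w = Matrix.det (Matrix.of fun i => rowVec H r (w i)) := rfl

lemma schurAlt_comp {H : ℤ → R} {r : ℕ} {g : Module.End ℚ V} {A : Matrix (Fin r) (Fin r) R}
    (h : ∀ v, rowVec H r (g v) = A.mulVec (rowVec H r v)) (w : Fin r → V) :
    schurAlt H r (fun i => g (w i)) = A.det * schurAlt H r w := by
  rw [schurAlt_eq_det, schurAlt_eq_det, mul_comm, ← Matrix.det_transpose A, ← Matrix.det_mul]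
  congr 1
  ext i j
  simp [h, Matrix.mul_apply, Matrix.mulVec, dotProduct, mul_comm]

/-- The shift b_n ↦ b_{n+1} moves the window (H_{n-r+1}, …, H_n) by one place, and the recurrence of
H expresses the new last entry by the old window. -/
lemma rowVec_sub_up {H : ℤ → R} {r : ℕ} {f : ℕ → R} (h : IsInverseSeq r f H) (t : ℚ) (v : V) :
    rowVec H r ((1 - t • up : Module.End ℚ V) v) =
      (upMatrix r f (algebraMap ℚ R t)).mulVec (rowVec H r v) := by
  have : rowVec H r ∘ₗ (1 - t • up : Module.End ℚ V) =
      ((upMatrix r f (algebraMap ℚ R t)).mulVecLin.restrictScalars ℚ) ∘ₗ rowVec H r := by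
    refine linearMap_V_ext fun n => ?_
    ext i
    have hi := i.2
    have hb : (1 - t • up : Module.End ℚ V) (b n) = b n - t • b (n + 1) := by
      rw [LinearMap.sub_apply, LinearMap.smul_apply, up_b]; rfl
    rw [LinearMap.comp_apply, hb, map_sub, map_smul, Pi.sub_apply, Pi.smul_apply, rowVec_b,
      rowVec_b]
    simp only [LinearMap.comp_apply, LinearMap.restrictScalars_apply, Matrix.mulVecLin_apply, Matrix.mulVec, dotProduct,
      upMatrix, Matrix.of_apply, rowVec_b, sub_mul, Finset.sum_sub_distrib, Algebra.smul_def,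
      mul_assoc, ← Finset.mul_sum]
    congr 1
    · simp
    congr 1
    split_ifs with hlt
    · rw [Finset.sum_eq_single ⟨i + 1, hlt⟩]
      · simp; congr 1; ring
      · intro j _ hj
        rw [if_neg (fun h => hj (Fin.ext h)), zero_mul]
      · simp
    · have hir : (i : ℕ) = r - 1 := by omega
      -- The recurrence at n + 1 is homogeneous because n ≥ 0.
      have h1 := h.sum_eq (n + 1)
      rw [if_neg (by omega), Finset.sum_range_succ', h.coeff_zero, one_mul] at h1
      rw [← Equiv.sum_comp Fin.revPerm, show ((n + 1 : ℕ) : ℤ) - r + 1 + i = n + 1 - (0 : ℕ) by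
        rw [hir]; omega, eq_neg_of_add_eq_zero_right h1,
        ← Fin.sum_univ_eq_sum_range fun i => f (i + 1) * H ((n : ℤ) + 1 - (i + 1 : ℕ)),
        ← Finset.sum_neg_distrib]
      refine Finset.sum_congr rfl fun j _ => ?_
      have hj := j.2
      rw [neg_mul]
      congr 3
      · simp; omega
      · simp; omega
  exact LinearMap.congr_fun this v

end SchurAlt

/-! ### σ̄₊(z) as multiplication by E_r(z). -/

/-- At a scalar z = t, the derivation σ̄₊ is the algebra map induced by v ↦ v - t σ_1 v. -/
lemma sum_smul_sigmaBarPlus (t : ℚ) {d : ℕ} {u : ExtV} (hu : u ∈ ⋀[ℚ]^d V) :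
    ∑ n ∈ Finset.range (d + 1), t ^ n • sigmaBarPlus n u =
      ExteriorAlgebra.map (1 - t • up : Module.End ℚ V) u := by
  refine exteriorPower_induction (P := fun d u => ∑ n ∈ Finset.range (d + 1), t ^ n •
    sigmaBarPlus n u = ExteriorAlgebra.map (1 - t • up : Module.End ℚ V) u)
    ?_ (by simp) (fun d u v hu hv => ?_) (fun d c u hu => ?_) (fun d v u hmem hu => ?_) hu
  · simp [sigmaBarPlus_one]
  · simp only [map_add, smul_add, Finset.sum_add_distrib, hu, hv]
  · simp only [map_smul, smul_comm _ c, ← Finset.smul_sum, hu]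
  · rw [map_mul, map_apply_ι, ← hu]
    simp only [sigmaBarPlus_ι_mul, smul_sub, Finset.sum_sub_distrib, LinearMap.sub_apply,
      Module.End.one_apply, LinearMap.smul_apply, map_sub, map_smul, sub_mul, Finset.mul_sum]
    congr 1
    · rw [Finset.sum_range_succ, sigmaBarPlus_eq_zero hmem (by push_cast; omega)]
      simp
    · rw [Finset.sum_range_succ', sigmaBarPlus_of_neg (n := ((0 : ℕ) : ℤ) - 1) (by simp)]
      simp [pow_succ, mul_smul]

lemma ofWedge_ιMulti {r : ℕ} (w : Fin r → V) :
    ofWedge r (ιMulti ℚ r w) = schurAlt (hSeq r) r w := by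
  rw [ofWedge, liftAlternating_apply_ιMulti, Pi.single_eq_same]

lemma exteriorPower_eqOn {M : Type*} [AddCommGroup M] [Module ℚ M] {d : ℕ} {f g : ExtV →ₗ[ℚ] M}
    (h : ∀ n : Fin d → ℕ, f (ιMulti ℚ d fun i => b (n i)) = g (ιMulti ℚ d fun i => b (n i)))
    {u : ExtV} (hu : u ∈ ⋀[ℚ]^d V) : f u = g u := by
  have h1 : f.compAlternatingMap (ιMulti ℚ d) = g.compAlternatingMap (ιMulti ℚ d) := by
    refine Module.Basis.ext_alternating (Finsupp.basisSingleOne (R := ℚ) (ι := ℕ)) fun n _ => ?_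
    simpa [b] using h n
  rw [← ιMulti_span_fixedDegree] at hu
  refine LinearMap.eqOn_span (s := Set.range (ιMulti ℚ d)) ?_ hu
  rintro _ ⟨w, rfl⟩
  exact congrArg (fun F => F w) h1

/-- Recovers the coefficients of z from all evaluations at rational t: polynomials over a domain
that agree at infinitely many points coincide. -/
lemma eq_of_sum_pow_smul_eq {R : Type*} [CommRing R] [IsDomain R] [Algebra ℚ R] {N : ℕ}
    {a c : ℕ → R} (h : ∀ t : ℚ, ∑ i ∈ Finset.range N, t ^ i • a i =
      ∑ i ∈ Finset.range N, t ^ i • c i) {n : ℕ} (hn : n < N) : a n = c n := by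
  have hpoly : ∑ i ∈ Finset.range N, Polynomial.monomial i (a i) =
      ∑ i ∈ Finset.range N, Polynomial.monomial i (c i) := by
    refine Polynomial.eq_of_infinite_eval_eq _ _ (Set.infinite_of_injective_forall_mem
      (f := algebraMap ℚ R) (algebraMap ℚ R).injective fun t => ?_)
    change Polynomial.eval _ _ = Polynomial.eval _ _
    simp only [Polynomial.eval_finsetSum, Polynomial.eval_monomial]
    simpa only [Algebra.smul_def, map_pow, mul_comm] using h t
  have h2 := congrArg (Polynomial.coeff · n) hpoly
  simpa [Polynomial.finsetSum_coeff, Polynomial.coeff_monomial, hn] using h2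

lemma mul_of_ιMulti {R : Type*} [CommRing R] [Algebra ℚ R] {d : ℕ} (F : ExtV →ₗ[ℚ] R)
    (g : ExtV →ₐ[ℚ] ExtV) (c : R) (h : ∀ w, F (g (ιMulti ℚ d w)) = c * F (ιMulti ℚ d w))
    {u : ExtV} (hu : u ∈ ⋀[ℚ]^d V) : F (g u) = c * F u :=
  exteriorPower_eqOn (f := F ∘ₗ g.toLinearMap) (g := LinearMap.mulLeft ℚ c ∘ₗ F) (fun _ => h _) hu

/-- At z = t, the map 1 - t σ_1 acts on the rows of the Schur determinant by `upMatrix`, whose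
determinant is E_r(t). Comparing powers of t gives the claim. -/
lemma ofWedge_sigmaBarPlus {r : ℕ} {u : ExtV} (hu : u ∈ ⋀[ℚ]^r V) (n : ℤ) :
    ofWedge r (sigmaBarPlus n u) = eps r n * ofWedge r u := by
  rcases lt_or_ge n 0 with h | h
  · simp [sigmaBarPlus_of_neg h, eps_of_neg h]
  lift n to ℕ using h
  have hmap (t : ℚ) : ofWedge r (ExteriorAlgebra.map (1 - t • up : Module.End ℚ V) u) =
      (∑ i ∈ Finset.range (r + 1), eps r i * (algebraMap ℚ (B r) t) ^ i) * ofWedge r u := by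
    have h1 (w : Fin r → V) :
        ofWedge r (ExteriorAlgebra.map (1 - t • up : Module.End ℚ V) (ιMulti ℚ r w)) =
        (∑ i ∈ Finset.range (r + 1), eps r i * (algebraMap ℚ (B r) t) ^ i) *
          ofWedge r (ιMulti ℚ r w) := by
      rw [map_apply_ιMulti, ofWedge_ιMulti, ofWedge_ιMulti, ← det_upMatrix _ _ (eps_zero r)]
      exact schurAlt_comp (rowVec_sub_up (isInverseSeq_hSeq r) t) w
    exact mul_of_ιMulti (ofWedge r) _ _ h1 hu
  rcases lt_or_ge r n with h | h
  · rw [sigmaBarPlus_eq_zero hu (by exact_mod_cast h), eps_of_gt (by exact_mod_cast h), map_zero,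
      zero_mul]
  refine eq_of_sum_pow_smul_eq (N := r + 1) (a := fun n => ofWedge r (sigmaBarPlus n u))
    (c := fun n => eps r n * ofWedge r u) (fun t => ?_) (Nat.lt_succ_of_le h)
  have := hmap t
  rw [← sum_smul_sigmaBarPlus t hu, map_sum, Finset.sum_mul] at this
  simp only [map_smul] at this
  rw [this]
  refine Finset.sum_congr rfl fun i _ => ?_
  rw [Algebra.smul_def, map_pow, ← mul_assoc, mul_comm (eps r i)]

/-- All columns after the first consist of the entries H_{i-j}, so the matrix is lower triangular
with diagonal H(l 0), 1, …, 1. -/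
lemma schurDet_of_tail_zero {R : Type*} [CommRing R] {H : ℤ → R} (h0 : H 0 = 1)
    (hneg : ∀ n < 0, H n = 0) {r : ℕ} {l : Fin (r + 1) → ℕ} (hl : ∀ i : Fin r, l i.succ = 0) :
    schurDet H l = H (l 0) := by
  rw [schurDet, Matrix.det_of_isLowerTriangular, Fin.prod_univ_succ]
  · simp [hl, h0]
  · intro i j hij
    have hij : i < j := hij
    obtain ⟨j, rfl⟩ := Fin.exists_succ_eq.2 (Fin.ne_zero_of_lt hij)
    have := Fin.lt_def.1 hij
    exact hneg _ (by rw [hl]; omega)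

lemma schurDet_zero {r : ℕ} : schurDet (hSeq r) (0 : Fin r → ℕ) = 1 := by
  rcases r with _ | r
  · simp [schurDet]
  · rw [schurDet_of_tail_zero (isInverseSeq_hSeq _).zero (isInverseSeq_hSeq _).of_neg (by simp)]
    exact (isInverseSeq_hSeq _).zero

/-! ### The `B_r`-module `⋀^r V` -/

lemma list_ofFn_pow_prod_single {M : Type*} [Monoid M] {r : ℕ} (g : Fin r → M)
    (h : ∀ i j, Commute (g i) (g j)) (m : Fin r → ℕ) (i : Fin r) :
    (List.ofFn fun j => g j ^ (m j + if i = j then 1 else 0)).prod =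
      g i * (List.ofFn fun j => g j ^ m j).prod := by
  induction r with
  | zero => exact i.elim0
  | succ r ih =>
    simp only [List.ofFn_succ, List.prod_cons]
    refine Fin.cases ?_ (fun i => ?_) i
    · simp [Fin.ext_iff, pow_succ', mul_assoc]
    · have := ih (fun j => g j.succ) (fun i j => h _ _) (fun j => m j.succ) i
      simp only [Fin.succ_inj, Fin.succ_ne_zero, if_false, add_zero]
      rw [this, ← mul_assoc, ← mul_assoc, ((h i.succ 0).pow_right _).eq]

lemma eAct_apply (i : ℕ) (u : ExtV) : eAct i u = (-1 : ℚ) ^ i • sigmaBarPlus i u := rfl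

lemma eAct_commute (i j : ℕ) : Commute (eAct i) (eAct j) := by
  refine LinearMap.ext fun u => ?_
  simp only [Module.End.mul_apply, eAct_apply, map_smul, sigmaBarPlus_comm (i : ℤ)]
  rw [smul_comm]

lemma toWedge_monomial (r : ℕ) (m : Fin r →₀ ℕ) : toWedge r (MvPolynomial.monomial m 1) =
    (List.ofFn fun i : Fin r => eAct ((i : ℕ) + 1) ^ m i).prod (bWedge (0 : Fin r → ℕ)) := by
  have := (MvPolynomial.basisMonomials (Fin r) ℚ).constr_basis ℚ (fun m =>
    (List.ofFn fun i : Fin r => eAct ((i : ℕ) + 1) ^ m i).prod (bWedge (0 : Fin r → ℕ))) m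
  rwa [MvPolynomial.coe_basisMonomials] at this

lemma toWedge_one (r : ℕ) : toWedge r 1 = bWedge (0 : Fin r → ℕ) := by
  have := toWedge_monomial r 0
  rw [show MvPolynomial.monomial (0 : Fin r →₀ ℕ) (1 : ℚ) = 1 from rfl] at this
  simpa using this

lemma toWedge_X_mul (r : ℕ) (i : Fin r) (p : B r) :
    toWedge r (MvPolynomial.X i * p) = eAct ((i : ℕ) + 1) (toWedge r p) := by
  have : toWedge r ∘ₗ LinearMap.mulLeft ℚ (MvPolynomial.X i) = eAct ((i : ℕ) + 1) ∘ₗ toWedge r := by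
    refine (MvPolynomial.basisMonomials (Fin r) ℚ).ext fun m => ?_
    simp only [MvPolynomial.coe_basisMonomials, LinearMap.comp_apply, LinearMap.mulLeft_apply]
    rw [MvPolynomial.X, MvPolynomial.monomial_mul, one_mul, toWedge_monomial, toWedge_monomial,
      ← Module.End.mul_apply, ← list_ofFn_pow_prod_single
        (fun j : Fin r => eAct ((j : ℕ) + 1)) (fun _ _ => eAct_commute _ _) m i]
    simp only [Finsupp.add_apply, Finsupp.single_apply, add_comm]
  exact LinearMap.congr_fun this p

lemma toWedge_mem (r : ℕ) (p : B r) : toWedge r p ∈ ⋀[ℚ]^r V := by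
  induction p using MvPolynomial.induction_on with
  | C a =>
    rw [MvPolynomial.C_eq_smul_one, map_smul, toWedge_one]
    exact Submodule.smul_mem _ _ (bWedge_mem _)
  | add p q hp hq => rw [map_add]; exact add_mem hp hq
  | mul_X p i hp =>
    rw [mul_comm, toWedge_X_mul, eAct_apply]
    exact Submodule.smul_mem _ _ (sigmaBarPlus_mem hp _)

lemma ofWedge_toWedge (r : ℕ) (p : B r) : ofWedge r (toWedge r p) = p := by
  induction p using MvPolynomial.induction_on with
  | C a =>
    rw [MvPolynomial.C_eq_smul_one, map_smul, map_smul, toWedge_one, ofWedge_bWedge, schurDet_zero]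
  | add p q hp hq => rw [map_add, map_add, hp, hq]
  | mul_X p i hp =>
    rw [mul_comm, toWedge_X_mul, eAct_apply, map_smul, ofWedge_sigmaBarPlus (toWedge_mem r p), hp,
      eps_natCast, e, if_neg (by omega), dif_pos (by simp)]
    simp only [add_tsub_cancel_right, Fin.eta]
    rw [Algebra.smul_def, map_pow, map_neg, map_one, ← mul_assoc, ← mul_assoc, ← mul_pow]
    simp

lemma sigmaBarPlus_zero (u : ExtV) : sigmaBarPlus 0 u = u := by
  induction u using ext_left_induction with
  | one => simp [sigmaBarPlus_one]
  | add u v hu hv => rw [map_add, hu, hv]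
  | smul c u hu => rw [map_smul, hu]
  | ι_mul v u hu => rw [sigmaBarPlus_ι_mul, hu, sigmaBarPlus_of_neg (n := 0 - 1) (by simp)]; simp

lemma sigmaBarPlus_mem_range {r : ℕ} {u : ExtV} (hu : u ∈ LinearMap.range (toWedge r)) (n : ℤ) :
    sigmaBarPlus n u ∈ LinearMap.range (toWedge r) := by
  obtain ⟨p, rfl⟩ := hu
  rcases lt_or_ge n 0 with h | h
  · simp [sigmaBarPlus_of_neg h]
  lift n to ℕ using h
  rcases n with _ | n
  · rw [Nat.cast_zero, sigmaBarPlus_zero]; exact ⟨p, rfl⟩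
  rcases lt_or_ge n r with h | h
  · have := toWedge_X_mul r ⟨n, h⟩ p
    rw [eAct_apply] at this
    refine ⟨(-1 : ℚ) ^ (n + 1) • (MvPolynomial.X ⟨n, h⟩ * p), ?_⟩
    rw [map_smul, this, smul_smul, ← mul_pow]
    simp
  · rw [sigmaBarPlus_eq_zero (toWedge_mem r p) (by push_cast; omega)]
    exact zero_mem _

/-- The coefficient of z^n in σ̄₊(z)((∑ σ_1^j v z^j) ∧ u) = v ∧ σ̄₊(z)u, which holds because σ̄₊(z)
sends the series to v. -/
lemma sum_sigmaBarPlus_up_pow (v : V) (u : ExtV) (n : ℕ) :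
    ∑ i ∈ Finset.range (n + 1), sigmaBarPlus i (ι ℚ ((up ^ (n - i)) v) * u) =
      ι ℚ v * sigmaBarPlus n u := by
  have h (i : ℕ) : sigmaBarPlus i (ι ℚ ((up ^ (n - i)) v) * u) =
      ι ℚ ((up ^ (n - i)) v) * sigmaBarPlus i u -
        ι ℚ (up ((up ^ (n - i)) v)) * sigmaBarPlus ((i : ℤ) - 1) u := sigmaBarPlus_ι_mul _ _ _
  -- The partial sums telescope.
  have key (k : ℕ) (hk : k ≤ n) :
      ∑ i ∈ Finset.range (k + 1), sigmaBarPlus i (ι ℚ ((up ^ (n - i)) v) * u) =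
        ι ℚ ((up ^ (n - k)) v) * sigmaBarPlus k u := by
    induction k with
    | zero =>
      rw [Finset.sum_range_one, h, sigmaBarPlus_of_neg (n := ((0 : ℕ) : ℤ) - 1) (by simp)]
      simp
    | succ k ih =>
      rw [Finset.sum_range_succ, ih (by omega), h, ← Module.End.mul_apply, ← pow_succ',
        show n - (k + 1) + 1 = n - k by omega]
      simp
  simpa using key n le_rfl

/-- Surjectivity of `toWedge`. A wedge with all indices below r is 0 or ±[b]^r_0; otherwise a
recurrence writes it through wedges of smaller index sum. -/
lemma ιMulti_b_mem_range {r : ℕ} (n : Fin r → ℕ) :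
    ιMulti ℚ r (fun i => b (n i)) ∈ LinearMap.range (toWedge r) := by
  induction hs : ∑ i, n i using Nat.strong_induction_on generalizing n with
  | _ s ih =>
  by_cases hlt : ∀ i, n i < r
  · by_cases hinj : Function.Injective n
    -- Here r distinct indices below r are a permutation of r - 1, …, 0; `Fin.rev` matches the
    -- decreasing order of `idx 0`.
    · let τ : Equiv.Perm (Fin r) := Equiv.ofBijective (fun i => Fin.rev ⟨n i, hlt i⟩)
        (Finite.injective_iff_bijective.1 fun i j hij => hinj
          (Fin.ext_iff.1 (Fin.rev_injective hij)))
      have h1 : (fun i => b (n i)) = (fun i => b (idx (0 : Fin r → ℕ) i)) ∘ τ := by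
        ext1 i
        simp only [Function.comp_apply, idx, τ, Equiv.ofBijective_apply, Fin.val_rev, Pi.zero_apply]
        congr 1
        have := hlt i
        omega
      rw [h1, AlternatingMap.map_perm, ← bWedge, ← toWedge_one]
      exact Submodule.smul_of_tower_mem _ _ ⟨1, rfl⟩
    · rw [ιMulti_eq_zero_of_not_inj]
      · exact zero_mem _
      · exact fun h => hinj (Function.Injective.of_comp (f := b) h)
  · push Not at hlt
    obtain ⟨j, hj⟩ := hlt
    rcases r with _ | r
    · exact j.elim0
    let n' := n ∘ Equiv.swap 0 j
    have hsum : n' 0 + ∑ i : Fin r, n' i.succ = s := by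
      rw [← Fin.sum_univ_succ, ← hs]
      exact Equiv.sum_comp (Equiv.swap 0 j) n
    have h1 : (fun i => b (n i)) = (fun i => b (n' i)) ∘ Equiv.swap 0 j := by
      ext1 i; simp [n']
    rw [h1, AlternatingMap.map_perm]
    refine Submodule.smul_of_tower_mem _ _ ?_
    have hn0 : r + 1 ≤ n' 0 := by simpa [n'] using hj
    obtain ⟨m, hm⟩ := Nat.exists_eq_add_of_le hn0
    set u := ιMulti ℚ r (fun i => b (n' i.succ)) with hu
    have hcons (a : ℕ) : ι ℚ (b a) * u =
        ιMulti ℚ (r + 1) (fun i => b (Fin.cons (α := fun _ => ℕ) a (fun i => n' i.succ) i)) := by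
      rw [ιMulti_succ_apply]; rfl
    -- As `u` has degree r, σ̄_{r+1} u = 0 and the whole sum vanishes. Its term i = 0 is the given
    -- wedge, since n' 0 = r + 1 + m; the term i has leading index smaller by i.
    have h2 := sum_sigmaBarPlus_up_pow (b m) u (r + 1)
    rw [sigmaBarPlus_eq_zero (ιMulti_mem _) (by push_cast; omega), mul_zero,
      Finset.sum_range_succ'] at h2
    have h3 : ιMulti ℚ (r + 1) (fun i => b (n' i)) =
        -∑ i ∈ Finset.range (r + 1),
          sigmaBarPlus ((i + 1 : ℕ) : ℤ) (ι ℚ ((up ^ (r + 1 - (i + 1))) (b m)) * u) := by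
      rw [eq_neg_iff_add_eq_zero, add_comm, ← h2]
      congr 1
      rw [Nat.cast_zero, sigmaBarPlus_zero, up_pow_b, hcons]
      congr 1
      ext1 i
      refine Fin.cases ?_ (fun i => ?_) i
      · simp [hm, add_comm]
      · simp
    rw [h3]
    refine neg_mem (sum_mem fun i hi => sigmaBarPlus_mem_range ?_ _)
    rw [up_pow_b, hcons]
    refine ih _ ?_ _ rfl
    rw [Fin.sum_univ_succ]
    simp only [Fin.cons_zero, Fin.cons_succ]
    omega

lemma toWedge_ofWedge {r : ℕ} {u : ExtV} (hu : u ∈ ⋀[ℚ]^r V) : toWedge r (ofWedge r u) = u := by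
  refine exteriorPower_eqOn (f := toWedge r ∘ₗ ofWedge r) (g := LinearMap.id) (fun n => ?_) hu
  obtain ⟨p, hp⟩ := ιMulti_b_mem_range n
  rw [← hp, LinearMap.comp_apply, ofWedge_toWedge]
  rfl

lemma ofWedge_injOn {r : ℕ} {u v : ExtV} (hu : u ∈ ⋀[ℚ]^r V) (hv : v ∈ ⋀[ℚ]^r V)
    (h : ofWedge r u = ofWedge r v) : u = v := by
  rw [← toWedge_ofWedge hu, h, toWedge_ofWedge hv]

lemma toWedge_bijOn (r : ℕ) :
    Set.BijOn (toWedge r) Set.univ ((⋀[ℚ]^r V : Submodule ℚ ExtV) : Set ExtV) :=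
  ⟨fun p _ => toWedge_mem r p, (Function.LeftInverse.injective (ofWedge_toWedge r)).injOn,
    fun u hu => ⟨ofWedge r u, trivial, toWedge_ofWedge hu⟩⟩

lemma toWedge_schurDet {r : ℕ} (l : Fin r → ℕ) : toWedge r (schurDet (hSeq r) l) = bWedge l := by
  rw [← ofWedge_bWedge, toWedge_ofWedge (bWedge_mem l)]

lemma sigmaBarPlus_toWedge {r : ℕ} (n : ℤ) (p : B r) :
    sigmaBarPlus n (toWedge r p) = toWedge r (eps r n * p) := by
  refine ofWedge_injOn (sigmaBarPlus_mem (toWedge_mem r p) n) (toWedge_mem r _) ?_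
  rw [ofWedge_sigmaBarPlus (toWedge_mem r p), ofWedge_toWedge, ofWedge_toWedge]

/-! ### `σ₋(z)` on the sequence `H_r` -/

lemma bWedge_cons_of_tail {d : ℕ} {l : Fin (d + 1) → ℕ} (hl : ∀ i : Fin d, l i.succ = 0) :
    bWedge l = ι ℚ (b (d + l 0)) * bWedge (0 : Fin d → ℕ) := by
  rw [bWedge, ιMulti_succ_apply, bWedge]
  congr 1
  congr 1
  ext1 i
  simp only [Matrix.vecTail, Function.comp_apply, idx, hl, Fin.val_succ, Pi.zero_apply]
  congr 1
  omega

lemma ι_b_mul_bWedge_zero {d n : ℕ} (h : n < d) :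
    ι ℚ (b n) * bWedge (0 : Fin d → ℕ) = 0 := by
  have : ι ℚ (b n) * bWedge (0 : Fin d → ℕ) = ιMulti ℚ (d + 1)
      (Fin.cons (b n) (fun i => b (idx (0 : Fin d → ℕ) i)) : Fin (d + 1) → V) := by
    rw [ιMulti_succ_apply, bWedge]; rfl
  rw [this]
  refine AlternatingMap.map_eq_zero_of_eq _ _ (i := 0) (j := (Fin.rev ⟨n, h⟩).succ) ?_
    (Fin.succ_ne_zero _).symm
  simp only [Fin.cons_zero, Fin.cons_succ, idx, Fin.val_rev, Pi.zero_apply]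
  congr 1
  omega

lemma sigmaMinus_ι_mul (n : ℤ) (v : V) (u : ExtV) : sigmaMinus n (ι ℚ v * u) =
    ι ℚ v * sigmaMinus n u + sigmaMinus (n + 1) (ι ℚ (down v) * u) := by
  rw [sigmaMinus_eq, hsZ_geo_ι_mul, sigmaMinus_eq, neg_add, sub_eq_add_neg (-n)]

lemma sigmaMinus_one (n : ℤ) : sigmaMinus n 1 = if n = 0 then 1 else 0 := by
  rw [sigmaMinus_eq, hsZ_one]; simp

/-- If σ₋ fixes u, it acts on b_m alone; the bound -m ≤ n is where the index of b would become
negative. -/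
lemma sigmaMinus_ι_b_mul {u : ExtV} (hu : ∀ n, sigmaMinus n u = if n = 0 then u else 0) (m : ℕ)
    (n : ℤ) : sigmaMinus n (ι ℚ (b m) * u) =
      if n ≤ 0 ∧ -(m : ℤ) ≤ n then ι ℚ (b ((m : ℤ) + n).toNat) * u else 0 := by
  induction m generalizing n with
  | zero =>
    rw [sigmaMinus_ι_mul, down_b_zero, hu]
    simp only [map_zero, zero_mul, add_zero]
    by_cases h : n = 0
    · simp [h]
    · rw [if_neg h, if_neg (by push_cast; omega), mul_zero]
  | succ m ih =>
    rw [sigmaMinus_ι_mul, down_b_succ, hu, ih]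
    push_cast
    rw [show (m : ℤ) + (n + 1) = m + 1 + n by ring]
    rcases lt_trichotomy n 0 with h | h | h
    · rw [if_neg h.ne, mul_zero, zero_add]
      exact if_congr (by omega) rfl rfl
    · subst h
      rw [if_pos rfl, if_neg (by omega), if_pos (by omega), add_zero]
      congr 3
    · rw [if_neg h.ne', if_neg (by omega), if_neg (by omega), mul_zero, add_zero]

/-- Lowering the leading factor b_d repeats one of b_{d-1}, …, b_0. -/
lemma sigmaMinus_bWedge_zero (d : ℕ) (n : ℤ) :
    sigmaMinus n (bWedge (0 : Fin d → ℕ)) = if n = 0 then bWedge (0 : Fin d → ℕ) else 0 := by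
  induction d generalizing n with
  | zero => simp only [bWedge, ιMulti_zero_apply, sigmaMinus_one]
  | succ d ih =>
    rw [bWedge_cons_of_tail (fun _ => rfl), sigmaMinus_ι_b_mul ih]
    by_cases h : n = 0
    · rw [if_pos h, if_pos (by simp; omega)]
      subst h; simp
    · rw [if_neg h]
      split_ifs with h1
      · exact ι_b_mul_bWedge_zero (by simp at h1 ⊢; omega)
      · rfl

/-- h_n is the Schur determinant of the one-row partition (n). -/
lemma toWedge_hSeq (d : ℕ) (n : ℤ) : toWedge (d + 1) (hSeq (d + 1) n) =
    if 0 ≤ n then ι ℚ (b (d + n.toNat)) * bWedge (0 : Fin d → ℕ) else 0 := by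
  split_ifs with h
  · lift n to ℕ using h
    let l : Fin (d + 1) → ℕ := Fin.cons n (fun _ => 0)
    have hl : ∀ i : Fin d, l i.succ = 0 := fun i => rfl
    have h1 := schurDet_of_tail_zero (isInverseSeq_hSeq (d + 1)).zero
      (isInverseSeq_hSeq (d + 1)).of_neg hl
    rw [show hSeq (d + 1) n = hSeq (d + 1) (l 0) from rfl, ← h1, toWedge_schurDet,
      bWedge_cons_of_tail hl]
    rfl
  · rw [hSeq_of_neg (not_le.1 h), map_zero]

lemma sigmaMinus_toWedge_hSeq {r : ℕ} (hr : 1 ≤ r) (n : ℤ) (i : ℕ) :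
    sigmaMinus (-(i : ℤ)) (toWedge r (hSeq r n)) = toWedge r (hSeq r (n - i)) := by
  obtain ⟨d, rfl⟩ : ∃ d, r = d + 1 := ⟨r - 1, by omega⟩
  rw [toWedge_hSeq, toWedge_hSeq]
  by_cases h : 0 ≤ n
  · rw [if_pos h, sigmaMinus_ι_b_mul (sigmaMinus_bWedge_zero d)]
    by_cases h1 : 0 ≤ n - i
    · rw [if_pos h1, if_pos (by push_cast; omega)]
      congr 3
      omega
    · rw [if_neg h1]
      split_ifs with h2
      -- The lowered index d + n - i is below d, so a factor repeats; this matches h_{n-i} = 0.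
      · exact ι_b_mul_bWedge_zero (by push_cast; omega)
      · rfl
  · rw [if_neg h, if_neg (by omega), map_zero]

/-! ### Expansions in Schur polynomials -/

/-- The determinant `det (x_j^{k - i + λ_i})_{1 ≤ i, j ≤ k}`. -/
def altDet {k : ℕ} (l : Fin k → ℕ) : MvPolynomial (Fin k) ℚ :=
  Matrix.det (Matrix.of fun i j : Fin k => (MvPolynomial.X j : MvPolynomial (Fin k) ℚ) ^ idx l i)

lemma alternant_eq_sign_mul_altDet {k : ℕ} (l : Fin k → ℕ) :
    alternant l = (Equiv.Perm.sign (Fin.revPerm : Equiv.Perm (Fin k)) : ℤ) * altDet l := by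
  have := Matrix.det_permute (Fin.revPerm : Equiv.Perm (Fin k))
    (Matrix.of fun i j : Fin k => (MvPolynomial.X j : MvPolynomial (Fin k) ℚ) ^ idx l i)
  rw [altDet, ← this, alternant]
  congr 1
  ext1 i j
  have := i.2
  simp only [Matrix.of_apply, Matrix.submatrix_apply, idx, Fin.revPerm_apply, Fin.val_rev, id]
  congr 1
  omega

/-- The reversal of rows multiplies both alternants by the same sign, so their quotient is still
`schur`. -/
lemma altDet_eq {k : ℕ} (l : Fin k → ℕ) : altDet l = altDet 0 * schur l := by
  have h := alternant_eq l
  rw [alternant_eq_sign_mul_altDet, alternant_eq_sign_mul_altDet, mul_assoc] at h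
  refine mul_left_cancel₀ ?_ h
  rcases Int.units_eq_one_or (Equiv.Perm.sign (Fin.revPerm : Equiv.Perm (Fin k))) with hs | hs <;>
    simp [hs]

lemma altDet_zero_ne_zero (k : ℕ) : altDet (0 : Fin k → ℕ) ≠ 0 := by
  intro h
  apply alternant_zero_ne_zero k
  rw [alternant_eq_sign_mul_altDet, h, mul_zero]

lemma altDet_zero (k : ℕ) : altDet (0 : Fin k → ℕ) =
    ∏ i : Fin k, ∏ j ∈ Finset.Ioi i, (MvPolynomial.X i - MvPolynomial.X j) := by
  have := Matrix.det_projVandermonde (R := MvPolynomial (Fin k) ℚ) (fun _ => 1) MvPolynomial.X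
  simp only [one_mul] at this
  rw [← this, ← Matrix.det_transpose, altDet]
  congr 1
  ext1 i j
  have := i.2
  simp only [Matrix.of_apply, Matrix.transpose_apply, Matrix.projVandermonde_apply, one_pow,
    one_mul, idx, Fin.val_rev, Pi.zero_apply]
  congr 1
  omega

lemma coeff_altDet {k : ℕ} (l : Fin k → ℕ) (a : Fin k →₀ ℕ) : (altDet l).coeff a =
    ∑ s : Equiv.Perm (Fin k), if ⇑a = idx l ∘ s then ((Equiv.Perm.sign s : ℤ) : ℚ) else 0 := by
  rw [altDet, Matrix.det_apply', MvPolynomial.coeff_sum]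
  refine Finset.sum_congr rfl fun s _ => ?_
  have h1 : ∏ i, Matrix.of (fun i j : Fin k =>
      (MvPolynomial.X j : MvPolynomial (Fin k) ℚ) ^ idx l i) (s i) i =
      MvPolynomial.monomial (Finsupp.equivFunOnFinite.symm (idx l ∘ s)) 1 := by
    rw [MvPolynomial.monomial_eq, Finsupp.prod_fintype _ _ (by simp)]
    simp
  rw [h1, show (((Equiv.Perm.sign s : ℤ)) : MvPolynomial (Fin k) ℚ) =
    MvPolynomial.C ((Equiv.Perm.sign s : ℤ) : ℚ) by simp, MvPolynomial.C_mul_monomial,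
    MvPolynomial.coeff_monomial, mul_one]
  refine if_congr ?_ rfl rfl
  rw [Equiv.symm_apply_eq, eq_comm]
  rfl

lemma idx_strictAnti {k : ℕ} {l : Fin k → ℕ} (hl : Antitone l) : StrictAnti (idx l) := by
  intro i j hij
  have h1 := hl hij.le
  have h2 := Fin.lt_def.1 hij
  have := j.2
  simp only [idx]
  omega

/-- Sort the exponents in decreasing order and subtract the staircase k - 1, …, 0. -/
lemma exists_idx_comp_perm {k : ℕ} {a : Fin k → ℕ} (ha : Function.Injective a) :
    ∃ (m : Ptn k) (s : Equiv.Perm (Fin k)), a = idx m.1 ∘ s := by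
  let c : Fin k → ℕ := a ∘ Tuple.sort a ∘ Fin.rev
  have hc : StrictAnti c := ((Tuple.monotone_sort a).strictMono_of_injective
    (ha.comp (Tuple.sort a).injective)).comp_strictAnti Fin.rev_strictAnti
  -- A strictly decreasing sequence of integers drops by at least one at each place. This yields
  -- both c i ≥ k - 1 - i and the monotonicity of the difference.
  have hle (n : ℕ) (i j : Fin k) (h : (j : ℕ) = i + n) : c j + n ≤ c i := by
    induction n generalizing j with
    | zero => rw [show j = i from Fin.ext h, add_zero]
    | succ n ih =>
      have hj := j.2
      have h1 := ih ⟨i + n, by omega⟩ rfl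
      have h2 : c j < c ⟨i + n, by omega⟩ := hc (by rw [Fin.lt_def]; simp; omega)
      omega
  have hge (i : Fin k) : k - 1 - i ≤ c i := by
    have hi := i.2
    have := hle (k - 1 - i) i ⟨k - 1, by omega⟩ (by simp; omega)
    omega
  refine ⟨⟨fun i => c i - (k - 1 - i), fun i j hij => ?_⟩,
    ((Fin.revPerm).trans (Tuple.sort a)).symm, ?_⟩
  · have hi := i.2
    have hj := j.2
    have hij' := Fin.le_def.1 hij
    have h1 := hle (j - i) i j (by omega)
    have h2 := hge i
    have h3 := hge j
    simp only
    omega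
  · rw [← Equiv.comp_symm_eq]
    ext i
    simp only [Equiv.symm_symm, Function.comp_apply, Equiv.trans_apply, Fin.revPerm_apply, idx]
    have := hge i
    change c i = _
    omega

/-- A strictly decreasing sequence is determined by its range, and it is injective, which then
determines the permutation. -/
lemma idx_comp_perm_inj {k : ℕ} {m m' : Ptn k} {s s' : Equiv.Perm (Fin k)}
    (h : idx m.1 ∘ s = idx m'.1 ∘ s') : m = m' ∧ s = s' := by
  have h1 : idx m.1 = idx m'.1 := by
    have hr : Set.range (idx m.1) = Set.range (idx m'.1) := by
      rw [← s.surjective.range_comp, h, s'.surjective.range_comp]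
    have := (StrictMono.range_inj
      ((idx_strictAnti m.2).comp Fin.rev_strictAnti)
      ((idx_strictAnti m'.2).comp Fin.rev_strictAnti)).1
      (by rw [Fin.rev_surjective.range_comp, Fin.rev_surjective.range_comp, hr])
    exact Fin.rev_surjective.injective_comp_right this
  have h2 : m = m' := by
    refine Subtype.ext (funext fun i => ?_)
    have := congrFun h1 i
    simpa [idx] using this
  subst h2
  refine ⟨rfl, Equiv.ext fun i => (idx_strictAnti m.2).injective (congrFun h i)⟩

/-- Functions of exponents that behave as the values of an alternating map at `b_{a_1}, ..., b_{a_k}`. -/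
structure IsAlternatingFun {k : ℕ} {S : Type*} [AddCommGroup S] (Ψ : (Fin k → ℕ) → S) : Prop where
  perm : ∀ a (s : Equiv.Perm (Fin k)), Ψ (a ∘ s) = Equiv.Perm.sign s • Ψ a
  not_injective : ∀ a, ¬ Function.Injective a → Ψ a = 0

lemma isAlternatingFun_of_alternatingMap {k : ℕ} {S : Type*} [AddCommGroup S] [Module ℚ S]
    {M : Type*} [AddCommGroup M] [Module ℚ M]
    (F : M [⋀^Fin k]→ₗ[ℚ] S) (c : ℕ → M) : IsAlternatingFun fun a : Fin k → ℕ => F (c ∘ a) where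
  perm a s := F.map_perm (c ∘ a) s
  not_injective _ ha := F.map_eq_zero_of_not_injective _ fun h => ha h.of_comp

/-- This is ∑_a Ψ(a) x^a = ∑_m altDet(m) Ψ(idx m): an injective exponent lies in the orbit of
exactly one `idx m`, by exactly one permutation, and Ψ vanishes at the others. -/
lemma IsAlternatingFun.finsum_coeff_altDet {k : ℕ} {S : Type*} [AddCommGroup S] [Module ℚ S]
    {Ψ : (Fin k → ℕ) → S} (hΨ : IsAlternatingFun Ψ) (a : Fin k →₀ ℕ) :
    ∑ᶠ m : Ptn k, (altDet m.1).coeff a • Ψ (idx m.1) = Ψ a := by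
  have h1 (m : Ptn k) : (altDet m.1).coeff a • Ψ (idx m.1) =
      ∑ s : Equiv.Perm (Fin k), if ⇑a = idx m.1 ∘ s then Ψ a else 0 := by
    rw [coeff_altDet, Finset.sum_smul]
    refine Finset.sum_congr rfl fun s _ => ?_
    split_ifs with h
    · rw [h, hΨ.perm, Int.cast_smul_eq_zsmul, Units.smul_def]
    · rw [zero_smul]
  simp only [h1]
  by_cases ha : Function.Injective a
  · obtain ⟨m, s, h⟩ := exists_idx_comp_perm ha
    rw [finsum_eq_single _ m, Finset.sum_eq_single s, if_pos h]
    · intro s' _ hs'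
      exact if_neg fun h' => hs' (idx_comp_perm_inj (h'.symm.trans h)).2
    · simp
    · intro m' hm'
      exact Finset.sum_eq_zero fun s' _ =>
        if_neg fun h' => hm' (idx_comp_perm_inj (h'.symm.trans h)).1
  · simp [hΨ.not_injective a ha]

lemma coeffZ_natCast {k : ℕ} (P : MvPolynomial (Fin k) ℚ) (a : Fin k →₀ ℕ) :
    coeffZ P (fun j => (a j : ℤ)) = P.coeff a := by
  rw [coeffZ, if_pos fun j => Int.natCast_nonneg _]
  congr 1
  ext j
  simp

lemma coeff_schur_finite {k : ℕ} (a : Fin k →₀ ℕ) :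
    {m : Ptn k | (schur m.1).coeff a ≠ 0}.Finite := by
  have := coeffZ_schur_finite fun j => (a j : ℤ)
  simpa only [coeffZ_natCast] using this

/-- The polynomial `altDet 0 = ∏_{i < j} (x_i - x_j)` as a power series over `S`. -/
def vandermondeSeries (k : ℕ) (S : Type*) [CommRing S] [Algebra ℚ S] : MvPowerSeries (Fin k) S :=
  ((altDet (0 : Fin k → ℕ)).map (algebraMap ℚ S) : MvPolynomial (Fin k) S)

lemma coeff_vandermondeSeries {k : ℕ} {S : Type*} [CommRing S] [Algebra ℚ S] (a : Fin k →₀ ℕ) :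
    MvPowerSeries.coeff a (vandermondeSeries k S) =
      algebraMap ℚ S ((altDet (0 : Fin k → ℕ)).coeff a) := by
  rw [vandermondeSeries, MvPolynomial.coeff_coe, MvPolynomial.coeff_map]

/-- The common source of both Schur expansions. Each altDet(m) is altDet(0) times `schur m`, and
altDet(0) can be cancelled because power series over a domain form a domain. -/
lemma coeff_eq_finsum_schur {k : ℕ} {S : Type*} [CommRing S] [IsDomain S] [Algebra ℚ S]
    {Ψ : (Fin k → ℕ) → S} (hΨ : IsAlternatingFun Ψ) {g : MvPowerSeries (Fin k) S}
    (hg : ∀ a, MvPowerSeries.coeff a (vandermondeSeries k S * g) = Ψ a) (a : Fin k →₀ ℕ) :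
    MvPowerSeries.coeff a g = ∑ᶠ m : Ptn k, (schur m.1).coeff a • Ψ (idx m.1) := by
  let f : MvPowerSeries (Fin k) S := fun a => ∑ᶠ m : Ptn k, (schur m.1).coeff a • Ψ (idx m.1)
  have hf (a : Fin k →₀ ℕ) :
    MvPowerSeries.coeff a f = ∑ᶠ m : Ptn k, (schur m.1).coeff a • Ψ (idx m.1) := rfl
  have hfin (q : Fin k →₀ ℕ) (c : ℚ) : (Function.support fun m : Ptn k =>
      (c * (schur m.1).coeff q) • Ψ (idx m.1)).Finite :=
    (coeff_schur_finite q).subset fun m hm => right_ne_zero_of_mul (left_ne_zero_of_smul hm)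
  have hmul : vandermondeSeries k S * f = vandermondeSeries k S * g := by
    ext a
    rw [hg, ← hΨ.finsum_coeff_altDet a, MvPowerSeries.coeff_mul]
    simp only [altDet_eq (Subtype.val _), MvPolynomial.coeff_mul, Finset.sum_smul]
    rw [finsum_sum_comm _ (fun (m : Ptn k) (p : (Fin k →₀ ℕ) × (Fin k →₀ ℕ)) =>
      ((altDet (0 : Fin k → ℕ)).coeff p.1 * (schur m.1).coeff p.2) • Ψ (idx m.1))
      fun p _ => hfin p.2 _]
    refine Finset.sum_congr rfl fun p _ => ?_
    rw [coeff_vandermondeSeries, hf, ← Algebra.smul_def, smul_finsum]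
    simp only [mul_smul]
  have hne : vandermondeSeries k S ≠ 0 := by
    rw [vandermondeSeries, Ne, MvPolynomial.coe_eq_zero_iff,
      map_eq_zero_iff _ (MvPolynomial.map_injective _ (algebraMap ℚ S).injective)]
    exact altDet_zero_ne_zero k
  have hfg : f = g := by
    have : vandermondeSeries k S * (f - g) = 0 := by rw [mul_sub, hmul, sub_self]
    exact sub_eq_zero.1 ((mul_eq_zero.1 this).resolve_left hne)
  rw [← hfg, hf]

/-! ### The vertex operator `Γ` -/

lemma multi_zero (D : ℤ → Module.End ℚ ExtV) (a : Fin 0 → ℤ) (u : ExtV) : multi D a u = u := by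
  simp [multi]

lemma multi_succ (D : ℤ → Module.End ℚ ExtV) {k : ℕ} (a : Fin (k + 1) → ℤ) (u : ExtV) :
    multi D a u = D (a 0) (multi D (fun j => a j.succ) u) := by
  simp [multi, List.ofFn_succ]

lemma multi_of_neg {D : ℤ → Module.End ℚ ExtV} (hD : ∀ n < 0, D n = 0) {k : ℕ} {a : Fin k → ℤ}
    {j : Fin k} (hj : a j < 0) : multi D a = 0 :=
  List.prod_eq_zero (List.mem_ofFn.2 ⟨j, hD _ hj⟩)

lemma multi_mem {D : ℤ → Module.End ℚ ExtV} {d : ℕ} (hD : ∀ n, ∀ u ∈ ⋀[ℚ]^d V, D n u ∈ ⋀[ℚ]^d V)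
    {k : ℕ} (a : Fin k → ℤ) {u : ExtV} (hu : u ∈ ⋀[ℚ]^d V) : multi D a u ∈ ⋀[ℚ]^d V := by
  induction k with
  | zero => rwa [multi_zero]
  | succ k ih => rw [multi_succ]; exact hD _ _ (ih _)

/-- Each factor contributes b_{j+1} - b_j z⁻¹ = -z⁻¹ (b_j - b_{j+1} z); hence the sign and the shift
of the exponent by d. -/
lemma sigmaBarMinus_map_up {d : ℕ} {u : ExtV} (hu : u ∈ ⋀[ℚ]^d V) (q : ℤ) :
    sigmaBarMinus q (ExteriorAlgebra.map up u) = (-1 : ℚ) ^ d • sigmaBarPlus (q + d) u := by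
  refine exteriorPower_induction (P := fun d u => ∀ q : ℤ, sigmaBarMinus q
    (ExteriorAlgebra.map up u) = (-1 : ℚ) ^ d • sigmaBarPlus (q + d) u)
    (fun q => ?_) (by simp) (fun d u v hu hv q => ?_) (fun d c u hu q => ?_)
    (fun d v u _ hu q => ?_) hu q
  · rw [map_one, sigmaBarMinus_one]; simp [sigmaBarPlus_one]
  · simp only [map_add, hu, hv, smul_add]
  · simp only [map_smul, hu, smul_comm c]
  · rw [map_mul, map_apply_ι, sigmaBarMinus_ι_mul, down_up, hu, hu, sigmaBarPlus_ι_mul, pow_succ]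
    rw [show q + 1 + d = q + ((d + 1 : ℕ) : ℤ) by push_cast; ring,
      show q + ((d + 1 : ℕ) : ℤ) - 1 = q + d by push_cast; ring, mul_neg_one, neg_smul, smul_sub,
      mul_smul_comm, mul_smul_comm, neg_sub]

lemma sigmaBarPlus_map_up_pow (m : ℕ) (n : ℤ) (u : ExtV) :
    sigmaBarPlus n (ExteriorAlgebra.map (up ^ m) u) =
      ExteriorAlgebra.map (up ^ m) (sigmaBarPlus n u) := by
  induction u using ext_left_induction generalizing n with
  | one => rw [map_one, sigmaBarPlus_one]; split_ifs <;> simp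
  | add u v hu hv => simp only [map_add, hu, hv]
  | smul c u hu => simp only [map_smul, hu]
  | ι_mul v u hu =>
    rw [map_mul, map_apply_ι, sigmaBarPlus_ι_mul, hu, hu, sigmaBarPlus_ι_mul, map_sub, map_mul,
      map_mul, map_apply_ι, map_apply_ι, ← Module.End.mul_apply, ← Module.End.mul_apply,
      ← pow_succ', ← pow_succ]

/-- The correction b_{j-1} z⁻¹ to a factor b_j repeats the next factor, or is 0 for j = 0. -/
lemma sigmaBarMinus_bWedge_zero (k : ℕ) (n : ℤ) :
    sigmaBarMinus n (bWedge (0 : Fin k → ℕ)) = if n = 0 then bWedge (0 : Fin k → ℕ) else 0 := by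
  induction k generalizing n with
  | zero => simp only [bWedge, ιMulti_zero_apply, sigmaBarMinus_one]
  | succ k ih =>
    have h : ι ℚ (down (b k)) * bWedge (0 : Fin k → ℕ) = 0 := by
      rcases k with _ | k
      · rw [down_b_zero]; simp
      · rw [down_b_succ, ι_b_mul_bWedge_zero (by omega)]
    rw [bWedge_cons_of_tail (fun _ => rfl), sigmaBarMinus_ι_mul, ih, ih, Pi.zero_apply, add_zero]
    split_ifs <;> simp [h]

lemma sigmaBarMinus_mul_bWedge_zero (k : ℕ) (n : ℤ) (u : ExtV) :
    sigmaBarMinus n (u * bWedge (0 : Fin k → ℕ)) =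
      sigmaBarMinus n u * bWedge (0 : Fin k → ℕ) := by
  induction u using ext_left_induction generalizing n with
  | one => rw [one_mul, sigmaBarMinus_bWedge_zero, sigmaBarMinus_one, ite_mul, one_mul, zero_mul]
  | add u v hu hv => simp only [map_add, add_mul, hu, hv]
  | smul c u hu => simp only [smul_mul_assoc, map_smul, hu]
  | ι_mul v u hu =>
    rw [mul_assoc, sigmaBarMinus_ι_mul, hu, hu, sigmaBarMinus_ι_mul, sub_mul, mul_assoc, mul_assoc]

lemma map_up_pow_mem {d : ℕ} {u : ExtV} (hu : u ∈ ⋀[ℚ]^d V) (m : ℕ) :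
    ExteriorAlgebra.map (up ^ m) u ∈ ⋀[ℚ]^d V := by
  refine exteriorPower_induction (P := fun d u => ExteriorAlgebra.map (up ^ m) u ∈ ⋀[ℚ]^d V)
    ?_ (by simp) (fun d u v hu hv => ?_) (fun d c u hu => ?_) (fun d v u _ hu => ?_) hu
  · rw [map_one]; exact ⟨1, by simp⟩
  · rw [map_add]; exact add_mem hu hv
  · rw [map_smul]; exact Submodule.smul_mem _ _ hu
  · rw [map_mul, map_apply_ι]; exact ι_mul_mem _ hu

/-- Each of the j operators σ̄₋ uses up one power of σ_1 when it turns into σ̄₊. -/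
lemma multi_sigmaBarMinus_map_up_pow (k m : ℕ) {d : ℕ} {u : ExtV} (hu : u ∈ ⋀[ℚ]^d V) {j : ℕ}
    (q : Fin j → ℤ) :
    multi sigmaBarMinus q (ExteriorAlgebra.map (up ^ (m + j)) u * bWedge (0 : Fin k → ℕ)) =
      (-1 : ℚ) ^ (j * d) • (ExteriorAlgebra.map (up ^ m) (multi sigmaBarPlus (fun i => q i + d) u) *
        bWedge (0 : Fin k → ℕ)) := by
  induction j generalizing m with
  | zero => simp [multi_zero]
  | succ j ih =>
    have hmem : multi sigmaBarPlus (fun i : Fin j => q i.succ + d) u ∈ ⋀[ℚ]^d V :=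
      multi_mem (fun n u hu => sigmaBarPlus_mem hu n) _ hu
    have hmap (x : ExtV) : ExteriorAlgebra.map (up ^ (m + 1)) x =
        ExteriorAlgebra.map up (ExteriorAlgebra.map (up ^ m) x) := by
      rw [← AlgHom.comp_apply, map_comp_map, pow_succ']; rfl
    rw [multi_succ, show m + (j + 1) = m + 1 + j by ring, ih, map_smul,
      sigmaBarMinus_mul_bWedge_zero, hmap, sigmaBarMinus_map_up (map_up_pow_mem hmem m),
      sigmaBarPlus_map_up_pow, multi_succ, smul_mul_assoc, smul_smul, ← pow_add, add_mul, one_mul]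

lemma finite_support_sigmaPlus_sigmaBarPlus {k : ℕ} (a : Fin k → ℤ) (F : (Fin k → ℤ) → ExtV → ExtV)
    (hF : ∀ q, F q 0 = 0) (u : ExtV) : (Function.support fun q : Fin k → ℤ =>
      multi sigmaPlus (a - q) (F q (multi sigmaBarPlus q u))).Finite := by
  refine (Set.finite_Icc 0 a).subset fun q hq => ?_
  rw [Set.mem_Icc]
  by_contra h
  rw [not_and_or, Pi.le_def, Pi.le_def] at h
  push Not at h
  apply hq
  rcases h with ⟨j, hj⟩ | ⟨j, hj⟩
  · simp only [multi_of_neg (fun _ => sigmaBarPlus_of_neg) hj, LinearMap.zero_apply, hF, map_zero]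
  · have : (a - q) j < 0 := by rw [Pi.sub_apply]; omega
    simp only [multi_of_neg (fun _ => sigmaPlus_of_neg) this, LinearMap.zero_apply]

lemma finite_support_of_int {M : Type*} [AddCommMonoid M] {f : ℤ → M} (s t : ℤ)
    (h1 : ∀ q < s, f q = 0) (h2 : ∀ q, t < q → f q = 0) : (Function.support f).Finite := by
  refine (Set.finite_Icc s t).subset fun q hq => ?_
  rw [Set.mem_Icc]
  by_contra h
  rw [not_and_or, not_le, not_le] at h
  exact hq (h.elim (h1 q) (h2 q))

/-- The coefficient of z^n in σ₊(σ̄₊ u ∧ y) = u ∧ σ₊ y, which combines multiplicativity of σ₊ with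
σ₊ σ̄₊ = 1; the case y = 1 is the latter. -/
lemma finsum_sigmaPlus_sigmaBarPlus_mul (n : ℤ) (u y : ExtV) :
    ∑ᶠ q : ℤ, sigmaPlus (n - q) (sigmaBarPlus q u * y) = u * sigmaPlus n y := by
  have hfin (n : ℤ) (F : ExtV →ₗ[ℚ] ExtV) (u : ExtV) : (Function.support fun q : ℤ =>
      sigmaPlus (n - q) (F (sigmaBarPlus q u * y))).Finite :=
    finite_support_of_int 0 n (fun q hq => by simp [sigmaBarPlus_of_neg hq])
      fun q hq => by rw [sigmaPlus_of_neg (by omega)]; rfl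
  induction u using ext_left_induction generalizing n with
  | one =>
    rw [finsum_eq_single _ 0]
    · simp [sigmaBarPlus_one]
    · intro q hq
      simp [sigmaBarPlus_one, hq]
  | add u v hu hv =>
    simp only [map_add, add_mul]
    have h1 := finsum_add_distrib (hfin n LinearMap.id u) (hfin n LinearMap.id v)
    simp only [LinearMap.id_apply, hu, hv] at h1
    exact h1
  | smul c u hu =>
    simp only [map_smul, smul_mul_assoc]
    rw [← smul_finsum, hu]
  | ι_mul v u hu =>
    -- The recurrences for σ₊ and σ̄₊ leave `g q - g (q - 1)`, which sums to 0 over ℤ.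
    let g : ℤ → ExtV := fun q => sigmaPlus (n - 1 - q) (ι ℚ (up v) * (sigmaBarPlus q u * y))
    have hg : (Function.support g).Finite := hfin (n - 1) (LinearMap.mulLeft ℚ (ι ℚ (up v))) u
    have hg' : (Function.support fun q => g (q - 1)).Finite :=
      hg.preimage (sub_left_injective (b := (1 : ℤ))).injOn
    have h1 : ∀ q, sigmaPlus (n - q) (sigmaBarPlus q (ι ℚ v * u) * y) =
        ι ℚ v * sigmaPlus (n - q) (sigmaBarPlus q u * y) + g q - g (q - 1) := by
      intro q
      rw [sigmaBarPlus_ι_mul, sub_mul, map_sub, mul_assoc, sigmaPlus_ι_mul, mul_assoc]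
      simp only [g]
      rw [show n - q - 1 = n - 1 - q by ring, show n - 1 - (q - 1) = n - q by ring]
    have h2 : (Function.support fun q => ι ℚ v * sigmaPlus (n - q) (sigmaBarPlus q u * y)).Finite :=
      (hfin n LinearMap.id u).subset fun q hq => right_ne_zero_of_mul hq
    have h3 : ∑ᶠ q, g (q - 1) = ∑ᶠ q, g q := finsum_comp_equiv (Equiv.subRight (1 : ℤ))
    have h4 : ∑ᶠ q, ι ℚ v * sigmaPlus (n - q) (sigmaBarPlus q u * y) =
        ι ℚ v * ∑ᶠ q, sigmaPlus (n - q) (sigmaBarPlus q u * y) :=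
      ((AddMonoidHom.mulLeft (ι ℚ v)).map_finsum (hfin n LinearMap.id u)).symm
    have h5 : (Function.support fun q =>
        ι ℚ v * sigmaPlus (n - q) (sigmaBarPlus q u * y) + g q).Finite :=
      (h2.union hg).subset (Function.support_add _ _)
    simp only [h1]
    rw [finsum_sub_distrib h5 hg', finsum_add_distrib h2 hg, h3, add_sub_cancel_right, h4, hu,
      mul_assoc]

lemma multi_sigmaBarPlus_comm {k : ℕ} (a : Fin k → ℤ) (n : ℤ) (u : ExtV) :
    sigmaBarPlus n (multi sigmaBarPlus a u) = multi sigmaBarPlus a (sigmaBarPlus n u) := by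
  induction k with
  | zero => simp only [multi_zero]
  | succ k ih => rw [multi_succ, multi_succ, sigmaBarPlus_comm, ih]

lemma finsum_multi_sigmaPlus_sigmaBarPlus_mul {k : ℕ} (a : Fin k → ℤ) (u y : ExtV) :
    ∑ᶠ q : Fin k → ℤ, multi sigmaPlus (a - q) (multi sigmaBarPlus q u * y) =
      u * multi sigmaPlus a y := by
  induction k generalizing u with
  | zero =>
    rw [finsum_eq_single _ 0 fun q hq => (hq (Subsingleton.elim _ _)).elim]
    simp only [multi_zero]
  | succ k ih =>
    have hfin {k : ℕ} (a : Fin k → ℤ) (u : ExtV) : (Function.support fun q : Fin k → ℤ =>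
        multi sigmaPlus (a - q) (multi sigmaBarPlus q u * y)).Finite :=
      finite_support_sigmaPlus_sigmaBarPlus a (fun _ x => x * y) (by simp) u
    rw [← finsum_comp_equiv (Fin.consEquiv fun _ => ℤ), finsum_curry]
    · have h (q₀ : ℤ) : ∑ᶠ q : Fin k → ℤ,
          multi sigmaPlus (a - Fin.consEquiv (fun _ => ℤ) (q₀, q))
            (multi sigmaBarPlus (Fin.consEquiv (fun _ => ℤ) (q₀, q)) u * y) =
          sigmaPlus (a 0 - q₀) (sigmaBarPlus q₀ u * multi sigmaPlus (fun j => a j.succ) y) := by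
        rw [← ih (fun j => a j.succ) (sigmaBarPlus q₀ u)]
        have := (sigmaPlus (a 0 - q₀)).toAddMonoidHom.map_finsum
          (hfin (fun j => a j.succ) (sigmaBarPlus q₀ u))
        refine Eq.trans ?_ this.symm
        refine finsum_congr fun q => ?_
        rw [multi_succ, multi_succ]
        -- `ih` was applied to σ̄_{q₀} u, with σ̄_{q₀} innermost, whereas `multi` puts it outermost.
        simp only [← multi_sigmaBarPlus_comm]
        rfl
      rw [finsum_congr h, finsum_sigmaPlus_sigmaBarPlus_mul, ← multi_succ]
    · exact (hfin a u).preimage (Fin.consEquiv fun _ => ℤ).injective.injOn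

/-- The shift by d is the factor ∏ z_j^{-d}. The sign (-1)^{kd} from σ̄₋ cancels the one from moving
u past a vector of degree k. -/
lemma Gamma_eq {k d : ℕ} (a : Fin k → ℤ) {u : ExtV} (hu : u ∈ ⋀[ℚ]^d V) :
    Gamma k a u = multi sigmaPlus (fun j => a j + d) (bWedge (0 : Fin k → ℕ)) * u := by
  have h1 (q : Fin k → ℤ) : multi sigmaBarMinus q (raise k u) = (-1 : ℚ) ^ (k * d) •
      (multi sigmaBarPlus (fun i => q i + d) u * bWedge (0 : Fin k → ℕ)) := by
    have := multi_sigmaBarMinus_map_up_pow k 0 hu q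
    rw [pow_zero, zero_add] at this
    rw [raise, LinearMap.comp_apply, LinearMap.mulRight_apply, AlgHom.toLinearMap_apply, this]
    congr 2
    exact LinearMap.congr_fun (congrArg AlgHom.toLinearMap (ExteriorAlgebra.map_id)) _
  have h2 := finsum_multi_sigmaPlus_sigmaBarPlus_mul (fun j => a j + d) u (bWedge (0 : Fin k → ℕ))
  rw [← finsum_comp_equiv (Equiv.addRight fun _ : Fin k => (d : ℤ))] at h2
  have hs : multi sigmaPlus (fun j => a j + d) (bWedge (0 : Fin k → ℕ)) ∈ ⋀[ℚ]^k V :=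
    multi_mem (fun n u hu => sigmaPlus_mem hu n) _ (bWedge_mem _)
  rw [mul_graded_comm hs hu, ← h2, smul_finsum, Gamma]
  refine finsum_congr fun q => ?_
  have h3 : (fun j => a j + (d : ℤ)) - (Equiv.addRight fun _ : Fin k => (d : ℤ)) q = a - q := by
    ext1 j
    simp
  rw [h1, map_smul, h3]
  rfl

/-! ### σ₊(z) as multiplication by 1/E_r(z), and the Cauchy identity. -/

lemma eq_zero_of_sum_eps_mul {r : ℕ} {D : ℤ → B r} (hneg : ∀ n < 0, D n = 0)
    (h : ∀ n, ∑ i ∈ Finset.range (r + 1), eps r i * D (n - i) = 0) (n : ℤ) : D n = 0 := by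
  rcases lt_or_ge n 0 with hn | hn
  · exact hneg n hn
  lift n to ℕ using hn
  induction n using Nat.strong_induction_on with
  | _ n ih =>
  have h1 := h n
  rw [Finset.sum_range_succ', Finset.sum_eq_zero, zero_add, Nat.cast_zero, eps_zero, one_mul,
    sub_zero] at h1
  · exact h1
  · intro i _
    have h2 : D ((n : ℤ) - (i + 1 : ℕ)) = 0 := by
      rcases lt_or_ge ((n : ℤ) - (i + 1 : ℕ)) 0 with hn | hn
      · exact hneg _ hn
      · have := ih (n - (i + 1)) (by omega)
        rwa [Nat.cast_sub (by omega)] at this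
    rw [h2, mul_zero]

/-- σ₊ inverts σ̄₊, which acts as E_r. The difference of the two sides, as a series in z, is
annihilated by E_r, whose constant term is 1. -/
lemma ofWedge_sigmaPlus {r : ℕ} {u : ExtV} (hu : u ∈ ⋀[ℚ]^r V) (n : ℤ) :
    ofWedge r (sigmaPlus n u) = hSeq r n * ofWedge r u := by
  rw [← sub_eq_zero]
  refine eq_zero_of_sum_eps_mul
    (D := fun n => ofWedge r (sigmaPlus n u) - hSeq r n * ofWedge r u) (fun n hn => ?_)
    (fun n => ?_) n
  · simp [sigmaPlus_of_neg hn, hSeq_of_neg hn]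
  · have h1 := finsum_sigmaPlus_sigmaBarPlus_mul n u 1
    rw [sigmaPlus_one, finsum_eq_finsetSum_of_support_subset (s := (Finset.range (r + 1)).map
      Nat.castEmbedding), Finset.sum_map] at h1
    · have h2 := congrArg (ofWedge r) h1
      rw [map_sum] at h2
      have h3 : ∀ i : ℕ, ofWedge r (sigmaPlus (n - i) (sigmaBarPlus i u * 1)) =
          eps r i * ofWedge r (sigmaPlus (n - i) u) := by
        intro i
        rw [mul_one, sigmaPlus_comm_sigmaBarPlus, ofWedge_sigmaBarPlus (sigmaPlus_mem hu _)]
      have h4 : ∑ i ∈ Finset.range (r + 1), eps r i * ofWedge r (sigmaPlus (n - i) u) =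
          ofWedge r (u * if n = 0 then 1 else 0) := by
        rw [← h2]
        exact Finset.sum_congr rfl fun i _ => (h3 i).symm
      simp only [mul_sub, Finset.sum_sub_distrib, ← mul_assoc, ← Finset.sum_mul]
      rw [h4, (isInverseSeq_hSeq r).sum_eq]
      split_ifs <;> simp
    · intro q hq
      have h0 : 0 ≤ q := by
        by_contra h
        exact hq (by simp [sigmaBarPlus_of_neg (not_le.1 h)])
      have hr : q ≤ r := by
        by_contra h
        exact hq (by simp [sigmaBarPlus_eq_zero hu (not_le.1 h)])
      simp only [Finset.coe_map, Set.mem_image, Finset.mem_coe, Finset.mem_range]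
      exact ⟨q.toNat, by omega, by simp [h0]⟩

lemma ofWedge_multi_sigmaPlus {r : ℕ} {u : ExtV} (hu : u ∈ ⋀[ℚ]^r V) {k : ℕ} (a : Fin k → ℤ) :
    ofWedge r (multi sigmaPlus a u) = (∏ j, hSeq r (a j)) * ofWedge r u := by
  induction k with
  | zero => simp [multi_zero]
  | succ k ih =>
    rw [multi_succ, ofWedge_sigmaPlus (multi_mem (fun n u hu => sigmaPlus_mem hu n) _ hu), ih,
      Fin.prod_univ_succ, mul_assoc]

/-- Column j of the Vandermonde determinant absorbs the one-variable series ∑ h_j(n) x_j^n;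
multiplication by x_j^{k-1-i} shifts its coefficients. -/
lemma coeff_vandermondeSeries_mul {k : ℕ} {S : Type*} [CommRing S] [Algebra ℚ S]
    {h : Fin k → ℤ → S} (hneg : ∀ j, ∀ n < 0, h j n = 0) {g : MvPowerSeries (Fin k) S}
    (hg : ∀ a, MvPowerSeries.coeff a g = ∏ j, h j (a j)) (a : Fin k →₀ ℕ) :
    MvPowerSeries.coeff a (vandermondeSeries k S * g) =
      Matrix.det (Matrix.of fun i j : Fin k => h j ((a j : ℤ) - idx (0 : Fin k → ℕ) i)) := by
  have hV : vandermondeSeries k S = ∑ s : Equiv.Perm (Fin k), MvPowerSeries.monomial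
      (Finsupp.equivFunOnFinite.symm (idx (0 : Fin k → ℕ) ∘ s)) ((Equiv.Perm.sign s : ℤ) : S) := by
    ext a
    rw [coeff_vandermondeSeries, coeff_altDet, map_sum, map_sum]
    refine Finset.sum_congr rfl fun s _ => ?_
    rw [MvPowerSeries.coeff_monomial, apply_ite (algebraMap ℚ S), map_zero, map_intCast]
    refine if_congr ?_ rfl rfl
    rw [Equiv.eq_symm_apply]
    rfl
  rw [hV, Finset.sum_mul, map_sum, Matrix.det_apply']
  refine Finset.sum_congr rfl fun s _ => ?_
  rw [MvPowerSeries.coeff_monomial_mul]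
  simp only [Matrix.of_apply]
  split_ifs with hle
  · rw [hg]
    congr 1
    refine Finset.prod_congr rfl fun j _ => ?_
    have := hle j
    simp only [Finsupp.equivFunOnFinite_symm_apply_apply, Function.comp_apply] at this
    simp [this]
  · rw [Finsupp.le_def] at hle
    push Not at hle
    obtain ⟨j, hj⟩ := hle
    simp only [Finsupp.equivFunOnFinite_symm_apply_apply, Function.comp_apply] at hj
    rw [Finset.prod_eq_zero (Finset.mem_univ j), mul_zero]
    exact hneg _ _ (by omega)

/-- The Cauchy identity ∏ 1/E_k(x_j) = ∑ s_m(x) Δ_m(H_k), coefficient by coefficient. -/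
lemma prod_hSeq_eq_finsum_schur {k : ℕ} (a : Fin k →₀ ℕ) : ∏ j, hSeq k (a j) =
    ∑ᶠ m : Ptn k, (schur m.1).coeff a • schurDet (hSeq k) m.1 := by
  let g : MvPowerSeries (Fin k) (B k) := fun a => ∏ j, hSeq k (a j)
  have hΨ := isAlternatingFun_of_alternatingMap (schurAlt (hSeq k) k) b
  have := coeff_eq_finsum_schur hΨ (g := g) (fun a => ?_) a
  · rw [show ∏ j, hSeq k (a j) = MvPowerSeries.coeff a g from rfl, this]
    refine finsum_congr fun m => ?_
    rw [← schurAlt_apply]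
    rfl
  · rw [coeff_vandermondeSeries_mul (fun _ _ => hSeq_of_neg) (g := g) (fun _ => rfl),
      schurAlt_eq_det, ← Matrix.det_transpose]
    congr 1
    ext1 i j
    have := j.2
    simp only [Matrix.transpose_apply, Matrix.of_apply, Function.comp_apply, rowVec_b, idx,
      Pi.zero_apply, add_zero]
    congr 1
    omega

lemma multi_sigmaPlus_bWedge_zero {k : ℕ} (a : Fin k → ℤ) :
    multi sigmaPlus a (bWedge (0 : Fin k → ℕ)) =
      ∑ᶠ m : Ptn k, coeffZ (schur m.1) a • bWedge m.1 := by
  have hfin : (Function.support fun m : Ptn k => coeffZ (schur m.1) a • bWedge m.1).Finite :=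
    (coeffZ_schur_finite a).subset fun m hm => left_ne_zero_of_smul hm
  by_cases h : ∀ j, 0 ≤ a j
  · refine ofWedge_injOn (multi_mem (fun n u hu => sigmaPlus_mem hu n) _ (bWedge_mem _))
      (finsum_induction (· ∈ ⋀[ℚ]^k V) (zero_mem _) (fun _ _ => add_mem)
        fun m => Submodule.smul_mem _ _ (bWedge_mem _)) ?_
    obtain ⟨a, rfl⟩ : ∃ a' : Fin k →₀ ℕ, a = fun j => (a' j : ℤ) :=
      ⟨Finsupp.equivFunOnFinite.symm fun j => (a j).toNat, by ext j; simp [h j]⟩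
    rw [ofWedge_multi_sigmaPlus (bWedge_mem _), ofWedge_bWedge, schurDet_zero, mul_one,
      prod_hSeq_eq_finsum_schur]
    refine Eq.trans ?_ ((ofWedge k).toAddMonoidHom.map_finsum hfin).symm
    refine finsum_congr fun m => ?_
    rw [LinearMap.toAddMonoidHom_coe, map_smul, ofWedge_bWedge, coeffZ_natCast]
  · have h' := h
    push Not at h'
    obtain ⟨j, hj⟩ := h'
    rw [multi_of_neg (fun _ => sigmaPlus_of_neg) hj]
    simp [coeffZ, h]

/-! ### The vertex operator `Γ*` -/

section MinusSeq

variable {R : Type*} [CommRing R]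

/-- The generating series of `minusSeq x H` is that of H divided by 1 - x t. -/
lemma minusSeq_sub {H : ℤ → R} (hneg : ∀ n < 0, H n = 0) (x : R) (n : ℤ) :
    minusSeq x H n - x * minusSeq x H (n - 1) = H n := by
  rcases lt_or_ge n 0 with hn | hn
  · rw [minusSeq, minusSeq, Int.toNat_of_nonpos hn.le, Int.toNat_of_nonpos (by omega)]
    simp [hneg n hn, hneg (n - 1) (by omega)]
  lift n to ℕ using hn
  rcases n with _ | n
  · simp [minusSeq, hneg]
  · rw [minusSeq, minusSeq, Int.toNat_natCast, show (((n + 1 : ℕ) : ℤ) - 1).toNat = n by simp,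
      Finset.sum_range_succ', Finset.mul_sum, add_sub_right_comm, ← Finset.sum_sub_distrib,
      Finset.sum_eq_zero]
    · simp
    · intro i _
      rw [show ((n + 1 : ℕ) : ℤ) - (i + 1 : ℕ) = ((n + 1 : ℕ) : ℤ) - 1 - i by push_cast; ring]
      ring

lemma minusSeq_of_neg {H : ℤ → R} (hneg : ∀ n < 0, H n = 0) (x : R) {n : ℤ} (hn : n < 0) :
    minusSeq x H n = 0 := by
  rw [minusSeq, Int.toNat_of_nonpos hn.le]
  simp [hneg n hn]

/-- The value `f_0 y^m + f_1 y^{m-1} + ⋯ + f_m` of the reversed polynomial. -/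
def revEval (m : ℕ) (f : ℕ → R) (y : R) : R := ∑ i ∈ Finset.range (m + 1), f i * y ^ (m - i)

/-- The coefficients of `(1 - x t) (f_0 + ⋯ + f_m t^m)`. -/
def mulLinear (m : ℕ) (f : ℕ → R) (x : R) (i : ℕ) : R :=
  (if i ≤ m then f i else 0) - (if i = 0 then 0 else x * f (i - 1))

lemma sum_mulLinear (m : ℕ) (f : ℕ → R) (x : R) (G : ℕ → R) :
    ∑ i ∈ Finset.range (m + 1 + 1), mulLinear m f x i * G i =
      ∑ i ∈ Finset.range (m + 1), f i * G i - x * ∑ i ∈ Finset.range (m + 1), f i * G (i + 1) := by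
  simp only [mulLinear, sub_mul, Finset.sum_sub_distrib]
  congr 1
  · rw [Finset.sum_range_succ, if_neg (by omega), zero_mul, add_zero]
    refine Finset.sum_congr rfl fun i hi => ?_
    rw [if_pos (by simpa [Nat.lt_succ_iff] using hi)]
  · rw [Finset.sum_range_succ', if_pos rfl, zero_mul, add_zero, Finset.mul_sum]
    refine Finset.sum_congr rfl fun i _ => ?_
    rw [if_neg (by omega), add_tsub_cancel_right, mul_assoc]

/-- The factor 1 - x t becomes the factor y - x of the reversed polynomial. -/
lemma revEval_mulLinear (m : ℕ) (f : ℕ → R) (x y : R) :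
    revEval (m + 1) (mulLinear m f x) y = (y - x) * revEval m f y := by
  have h := sum_mulLinear m f x fun i => y ^ (m + 1 - i)
  rw [revEval, h, revEval, sub_mul]
  congr 1
  · rw [Finset.mul_sum]
    refine Finset.sum_congr rfl fun i hi => ?_
    have : i ≤ m := by simpa [Nat.lt_succ_iff] using hi
    rw [Nat.succ_sub this, pow_succ]
    ring
  · simp only [Nat.add_sub_add_right]

variable {m : ℕ} {f : ℕ → R} {H : ℤ → R}

lemma IsInverseSeq.minusSeq (h : IsInverseSeq m f H) (x : R) :
    IsInverseSeq (m + 1) (mulLinear m f x) (minusSeq x H) where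
  coeff_zero := by simp [mulLinear, h.coeff_zero]
  of_neg _ hn := minusSeq_of_neg h.of_neg x hn
  sum_eq n := by
    rw [sum_mulLinear m f x fun i => ExtVertex.minusSeq x H (n - i), ← h.sum_eq, Finset.mul_sum,
      ← Finset.sum_sub_distrib]
    refine Finset.sum_congr rfl fun i _ => ?_
    rw [← minusSeq_sub h.of_neg x (n - i), show n - ((i + 1 : ℕ) : ℤ) = n - i - 1 by push_cast; ring]
    ring

/-- The product of f with H/(1 - x t) is 1/(1 - x t). -/
lemma IsInverseSeq.sum_mul_minusSeq (h : IsInverseSeq m f H) (x : R) (n : ℕ) :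
    ∑ i ∈ Finset.range (m + 1), f i * ExtVertex.minusSeq x H (n - i) = x ^ n := by
  have key (n : ℤ) : ∑ i ∈ Finset.range (m + 1), f i * ExtVertex.minusSeq x H (n - i) =
      x * ∑ i ∈ Finset.range (m + 1), f i * ExtVertex.minusSeq x H (n - 1 - i) +
        if n = 0 then 1 else 0 := by
    rw [← h.sum_eq, Finset.mul_sum, ← Finset.sum_add_distrib]
    refine Finset.sum_congr rfl fun i _ => ?_
    rw [← minusSeq_sub h.of_neg x (n - i), show n - 1 - (i : ℤ) = n - i - 1 by ring]
    ring
  induction n with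
  | zero =>
    rw [key, Finset.sum_eq_zero]
    · simp
    · intro i _
      rw [minusSeq_of_neg h.of_neg x (by push_cast; omega), mul_zero]
  | succ n ih =>
    rw [key, if_neg (by omega), add_zero, show ((n + 1 : ℕ) : ℤ) - 1 = n by simp, ih, pow_succ']

variable [Algebra ℚ R]

/-- Multiply the determinant by the companion matrix with top row f_m, …, f_0, of determinant
`revEval m f x`. The top row of the product is x^{w_p}, by `IsInverseSeq.sum_mul_minusSeq`; the
other rows are the windows of H, by `minusSeq_sub`. Expand along the top row. -/
lemma IsInverseSeq.revEval_mul_schurAlt (h : IsInverseSeq m f H) (x : R) (w : Fin (m + 1) → ℕ) :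
    revEval m f x * schurAlt (ExtVertex.minusSeq x H) (m + 1) (fun i => b (w i)) =
      ∑ p : Fin (m + 1), (-1) ^ (p : ℕ) * x ^ w p *
        schurAlt H m (fun i => b (w (p.succAbove i))) := by
  have hrev : revEval m f x = ∑ j : Fin (m + 1), f (m - j) * x ^ (j : ℕ) := by
    rw [revEval, ← Finset.sum_range_reflect, ← Fin.sum_univ_eq_sum_range
      fun i => f (m + 1 - 1 - i) * x ^ (m - (m + 1 - 1 - i))]
    refine Finset.sum_congr rfl fun j _ => ?_
    have := j.2
    rw [show m + 1 - 1 - (j : ℕ) = m - j by omega, show m - (m - (j : ℕ)) = j by omega]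
  rw [hrev, ← det_companion (fun j : Fin (m + 1) => f (m - j)) x, schurAlt_eq_det,
    ← Matrix.det_transpose (Matrix.of fun i => rowVec (ExtVertex.minusSeq x H) (m + 1) (b (w i))),
    ← Matrix.det_mul, Matrix.det_succ_row_zero]
  have hsub (n : ℤ) := minusSeq_sub h.of_neg x n
  refine Finset.sum_congr rfl fun p _ => ?_
  congr 1
  · congr 1
    rw [← h.sum_mul_minusSeq x (w p), Matrix.mul_apply, ← Finset.sum_range_reflect,
      ← Fin.sum_univ_eq_sum_range
        fun i => f (m + 1 - 1 - i) * ExtVertex.minusSeq x H (w p - (m + 1 - 1 - i : ℕ))]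
    refine Finset.sum_congr rfl fun j _ => ?_
    have := j.2
    simp only [Matrix.of_apply, Fin.cases_zero, Matrix.transpose_apply, rowVec_b]
    rw [show m + 1 - 1 - (j : ℕ) = m - j by omega]
    congr 2
    omega
  · rw [schurAlt_eq_det, ← Matrix.det_transpose]
    congr 1
    ext i j
    simp only [Matrix.transpose_apply, Matrix.submatrix_apply, Matrix.mul_apply, Matrix.of_apply,
      Fin.cases_succ, rowVec_b, sub_mul, Finset.sum_sub_distrib, ite_mul, one_mul, zero_mul,
      Finset.sum_ite_eq', Finset.mem_univ, if_true, Fin.val_succ,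
      Fin.val_castSucc]
    rw [← hsub]
    congr 2
    · push_cast; ring
    · congr 1
      push_cast; ring

/-- The linear map `⋀V → R` with `[b]^r_λ ↦ Δ_λ(H)`, extended by `0` to the other degrees. -/
def schurLin (H : ℤ → R) (r : ℕ) : ExtV →ₗ[ℚ] R :=
  liftAlternating (Pi.single r (schurAlt H r))

lemma schurLin_ιMulti (H : ℤ → R) {r : ℕ} (w : Fin r → V) :
    schurLin H r (ιMulti ℚ r w) = schurAlt H r w := by
  rw [schurLin, liftAlternating_apply_ιMulti, Pi.single_eq_same]

end MinusSeq

/-! ### Contractions against basis forms. -/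

lemma contractLeft_ιMulti (d : Module.Dual ℚ V) {m : ℕ} (w : Fin (m + 1) → V) :
    (CliffordAlgebra.contractLeft d (ιMulti ℚ (m + 1) w : ExtV) : ExtV) =
      ∑ p : Fin (m + 1), ((-1 : ℚ) ^ (p : ℕ) * d (w p)) • ιMulti ℚ m (fun i => w (p.succAbove i)) := by
  induction m with
  | zero =>
    rw [ιMulti_succ_apply]
    have := CliffordAlgebra.contractLeft_ι_mul (Q := (0 : QuadraticForm ℚ V)) (d := d) (w 0) 1
    simp only [CliffordAlgebra.contractLeft_one, mul_zero, sub_zero] at this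
    simpa [ιMulti_zero_apply] using this
  | succ m ih =>
    rw [ιMulti_succ_apply]
    have h1 := CliffordAlgebra.contractLeft_ι_mul (Q := (0 : QuadraticForm ℚ V)) (d := d) (w 0)
      (ιMulti ℚ (m + 1) (fun i => w i.succ) : ExtV)
    refine h1.trans ?_
    rw [ih, Fin.sum_univ_succ (n := m + 1), sub_eq_add_neg]
    congr 1
    · simp
    · rw [Finset.mul_sum, ← Finset.sum_neg_distrib]
      refine Finset.sum_congr rfl fun p _ => ?_
      rw [ιMulti_succ_apply]
      change -(ι ℚ (w 0) * _) = _
      rw [mul_smul_comm, ← neg_smul, Fin.val_succ, pow_succ, mul_neg_one, neg_mul]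
      simp [Matrix.vecTail, Function.comp_def]

lemma contractLeft_mem (d : Module.Dual ℚ V) {m : ℕ} {u : ExtV} (hu : u ∈ ⋀[ℚ]^(m + 1) V) :
    (CliffordAlgebra.contractLeft d u : ExtV) ∈ ⋀[ℚ]^m V := by
  rw [← ιMulti_span_fixedDegree] at hu
  induction hu using Submodule.span_induction with
  | zero => rw [map_zero]; exact zero_mem _
  | add u v _ _ hu hv => rw [map_add]; exact add_mem hu hv
  | smul c u _ hu => rw [map_smul]; exact Submodule.smul_mem _ _ hu
  | mem u hu =>
    obtain ⟨w, rfl⟩ := hu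
    rw [contractLeft_ιMulti]
    exact sum_mem fun p _ => Submodule.smul_mem _ _ (ιMulti_mem _)

lemma span_ιMulti_b (d : ℕ) :
    Submodule.span ℚ (Set.range fun n : Fin d → ℕ => ιMulti ℚ d fun i => b (n i)) = ⋀[ℚ]^d V := by
  have hb : Submodule.span ℚ (Set.range b) = ⊤ := by
    have := (Finsupp.basisSingleOne (R := ℚ) (ι := ℕ)).span_eq
    rwa [Finsupp.coe_basisSingleOne] at this
  rw [← exteriorPower.ιMulti_span_fixedDegree_of_span_eq_top ℚ d V hb]
  congr 1
  ext u
  constructor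
  · rintro ⟨n, rfl⟩
    exact ⟨fun i => b (n i), Set.range_subset_iff.2 fun i => ⟨n i, rfl⟩, rfl⟩
  · rintro ⟨w, hw, rfl⟩
    choose n hn using Set.range_subset_iff.1 hw
    exact ⟨n, by simp [hn]⟩

/-- Contraction against `β_n`. -/
abbrev contractβ (n : ℕ) : Module.End ℚ ExtV := CliffordAlgebra.contractLeft (β n)

lemma β_b (n m : ℕ) : β n (b m) = if m = n then 1 else 0 := by
  rw [β, b, Finsupp.lapply_apply, Finsupp.single_apply]

/-- The sequence `σ₋(w_1) ⋯ σ₋(w_k) H`, with `x_j = w_j⁻¹`. -/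
def minusIter {R : Type*} [CommRing R] {k : ℕ} (x : Fin k → R) (H : ℤ → R) : ℤ → R :=
  (List.ofFn fun j => minusSeq (x j)).foldr (fun T H => T H) H

lemma minusIter_succ {R : Type*} [CommRing R] {k : ℕ} (x : Fin (k + 1) → R) (H : ℤ → R) :
    minusIter x H = minusSeq (x 0) (minusIter (fun j => x j.succ) H) := by
  simp [minusIter, List.ofFn_succ]

/-- Every variable adds a root to the reversed polynomial; evaluated at another variable, these
roots give the Vandermonde factors. -/
lemma IsInverseSeq.minusIter {R : Type*} [CommRing R] {m : ℕ} {f : ℕ → R} {H : ℤ → R}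
    (h : IsInverseSeq m f H) {k : ℕ} (x : Fin k → R) :
    ∃ f', IsInverseSeq (m + k) f' (minusIter x H) ∧
      ∀ y, revEval (m + k) f' y = (∏ j, (y - x j)) * revEval m f y := by
  induction k with
  | zero => exact ⟨f, by simpa [ExtVertex.minusIter] using h, by simp⟩
  | succ k ih =>
    obtain ⟨f', h1, h2⟩ := ih fun j => x j.succ
    refine ⟨mulLinear (m + k) f' (x 0), ?_, fun y => ?_⟩
    · rw [minusIter_succ]
      exact h1.minusSeq (x 0)
    · rw [← add_assoc, revEval_mulLinear, h2, Fin.prod_univ_succ, mul_assoc]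

/-! ### Schur determinants of σ₋(w_k)H as sums of contractions. -/

section Peel

variable {R : Type*} [CommRing R] [Algebra ℚ R] {m : ℕ} {f : ℕ → R} {H : ℤ → R}

lemma sum_range_of_contractβ_eq_zero {N M : ℕ} {u : ExtV} (hN : ∀ n, N ≤ n → contractβ n u = 0)
    (hM : N ≤ M) (x : R) (F : ExtV →ₗ[ℚ] R) :
    ∑ n ∈ Finset.range M, x ^ n * F (contractβ n u) =
      ∑ n ∈ Finset.range N, x ^ n * F (contractβ n u) := by
  refine (Finset.sum_subset (by simpa using hM) fun n _ hn => ?_).symm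
  rw [hN n (by simpa using hn), map_zero, mul_zero]

/-- The row expansion in invariant form: its alternating sum is ∑ x^n β_n ⌟ u. -/
lemma IsInverseSeq.revEval_mul_schurLin (h : IsInverseSeq m f H) (x : R) {u : ExtV}
    (hu : u ∈ ⋀[ℚ]^(m + 1) V) {N : ℕ} (hN : ∀ n, N ≤ n → contractβ n u = 0) :
    revEval m f x * schurLin (ExtVertex.minusSeq x H) (m + 1) u =
      ∑ n ∈ Finset.range N, x ^ n * schurLin H m (contractβ n u) := by
  have key : ∃ M₀, ∀ M, M₀ ≤ M →
      revEval m f x * schurLin (ExtVertex.minusSeq x H) (m + 1) u =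
        ∑ n ∈ Finset.range M, x ^ n * schurLin H m (contractβ n u) := by
    -- The summands of a spanning expression of u need not be killed by β_n for n ≥ N, so the
    -- induction proves the identity for all large M.
    clear hN
    rw [← span_ιMulti_b] at hu
    induction hu using Submodule.span_induction with
    | zero => exact ⟨0, fun M _ => by simp⟩
    | add u v _ _ hu hv =>
      obtain ⟨M₁, h1⟩ := hu
      obtain ⟨M₂, h2⟩ := hv
      refine ⟨max M₁ M₂, fun M hM => ?_⟩
      simp only [map_add, mul_add, Finset.sum_add_distrib]
      rw [h1 M (le_trans (le_max_left _ _) hM), h2 M (le_trans (le_max_right _ _) hM)]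
    | smul c u _ hu =>
      obtain ⟨M₁, h1⟩ := hu
      refine ⟨M₁, fun M hM => ?_⟩
      simp only [map_smul, mul_smul_comm, ← Finset.smul_sum]
      rw [h1 M hM]
    | mem u hu =>
      obtain ⟨w, rfl⟩ := hu
      refine ⟨∑ i, w i + 1, fun M hM => ?_⟩
      simp only [schurLin_ιMulti]
      rw [h.revEval_mul_schurAlt]
      have h1 (n : ℕ) : x ^ n * schurLin H m (contractβ n (ιMulti ℚ (m + 1) fun i => b (w i))) =
          ∑ p : Fin (m + 1), if w p = n then (-1) ^ (p : ℕ) * x ^ n *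
            schurAlt H m (fun i => b (w (p.succAbove i))) else 0 := by
        rw [contractLeft_ιMulti, map_sum, Finset.mul_sum]
        refine Finset.sum_congr rfl fun p _ => ?_
        rw [map_smul, schurLin_ιMulti, β_b]
        split_ifs
        · rw [mul_one, Algebra.smul_def, map_pow, map_neg, map_one]
          ring
        · simp
      simp only [h1]
      rw [Finset.sum_comm]
      refine Finset.sum_congr rfl fun p _ => ?_
      have : w p < M := lt_of_lt_of_le (Nat.lt_succ_of_le (Finset.single_le_sum
        (f := w) (fun _ _ => Nat.zero_le _) (Finset.mem_univ p))) hM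
      rw [Finset.sum_ite_eq, if_pos (Finset.mem_range.2 this)]
  obtain ⟨M₀, hM₀⟩ := key
  rw [hM₀ (max M₀ N) (le_max_left _ _), sum_range_of_contractβ_eq_zero hN (le_max_right _ _)]

/-- The contraction against `β_{a_1} ∧ ⋯ ∧ β_{a_k}`. -/
def contractSeq {k : ℕ} (a : Fin k → ℕ) : Module.End ℚ ExtV :=
  ((List.ofFn fun i => contractβ (a i)).reverse).prod

lemma contract_eq_contractSeq {k : ℕ} (n : Fin k → ℕ) : contract n = contractSeq (idx n) := rfl

lemma contractSeq_zero (a : Fin 0 → ℕ) (u : ExtV) : contractSeq a u = u := by simp [contractSeq]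

lemma contractSeq_succ {k : ℕ} (a : Fin (k + 1) → ℕ) (u : ExtV) :
    contractSeq a u = contractSeq (fun i => a i.succ) (contractβ (a 0) u) := by
  simp [contractSeq, List.ofFn_succ]

lemma contractSeq_mem {k : ℕ} (a : Fin k → ℕ) {d : ℕ} {u : ExtV} (hu : u ∈ ⋀[ℚ]^(d + k) V) :
    contractSeq a u ∈ ⋀[ℚ]^d V := by
  induction k generalizing u with
  | zero => rwa [contractSeq_zero]
  | succ k ih =>
    rw [contractSeq_succ]
    exact ih _ (contractLeft_mem _ hu)

/-- Contractions anticommute, so one bound N serves for all successive contractions. -/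
lemma contractβ_contractβ_eq_zero {N : ℕ} {u : ExtV} (hN : ∀ n, N ≤ n → contractβ n u = 0) (p : ℕ) :
    ∀ n, N ≤ n → contractβ n (contractβ p u) = 0 := by
  intro n hn
  have := CliffordAlgebra.contractLeft_comm (Q := (0 : QuadraticForm ℚ V)) (d := β n) (d' := β p) u
  refine this.trans ?_
  have h := hN n hn
  rw [contractβ] at h
  rw [h, map_zero, neg_zero]

/-- Peel off x_0 first. The sequence for the other variables inverts a polynomial whose reversed
value at x_0 is ∏ (x_0 - x_j) · `revEval m f (x 0)`; the product is the part of the Vandermonde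
determinant that involves x_0. -/
lemma IsInverseSeq.prod_mul_schurLin_minusIter (h : IsInverseSeq m f H) {k : ℕ} (x : Fin k → R)
    {u : ExtV} (hu : u ∈ ⋀[ℚ]^(m + k) V) {N : ℕ} (hN : ∀ n, N ≤ n → contractβ n u = 0) :
    (∏ i : Fin k, ∏ j ∈ Finset.Ioi i, (x i - x j)) * ((∏ i, revEval m f (x i)) *
        schurLin (ExtVertex.minusIter x H) (m + k) u) =
      ∑ a : Fin k → Fin N, (∏ i, x i ^ (a i : ℕ)) *
        schurLin H m (contractSeq (fun i => (a i : ℕ)) u) := by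
  induction k generalizing u with
  | zero => simp [ExtVertex.minusIter, contractSeq_zero]
  | succ k ih =>
    obtain ⟨f', h1, h2⟩ := h.minusIter fun j => x j.succ
    have h3 := h1.revEval_mul_schurLin (x 0) hu hN
    rw [h2] at h3
    have h4 : ∀ n, (∏ i : Fin k, ∏ j ∈ Finset.Ioi i, (x i.succ - x j.succ)) *
        ((∏ i : Fin k, revEval m f (x i.succ)) *
          schurLin (ExtVertex.minusIter (fun j => x j.succ) H) (m + k) (contractβ n u)) =
        ∑ a : Fin k → Fin N, (∏ i, x i.succ ^ (a i : ℕ)) *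
          schurLin H m (contractSeq (fun i => (a i : ℕ)) (contractβ n u)) := fun n =>
      ih (fun j => x j.succ) (contractLeft_mem _ hu) (contractβ_contractβ_eq_zero hN n)
    rw [Fin.prod_univ_succ, Fin.prod_univ_succ, Fin.prod_Ioi_zero, minusIter_succ]
    simp only [Fin.prod_Ioi_succ]
    calc _ = (∏ i : Fin k, ∏ j ∈ Finset.Ioi i, (x i.succ - x j.succ)) *
        ((∏ i : Fin k, revEval m f (x i.succ)) * ((∏ j : Fin k, (x 0 - x j.succ)) *
          revEval m f (x 0) * schurLin (ExtVertex.minusSeq (x 0)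
            (ExtVertex.minusIter (fun j => x j.succ) H)) (m + k + 1) u)) := by ring_nf
      _ = ∑ n ∈ Finset.range N, x 0 ^ n * ((∏ i : Fin k, ∏ j ∈ Finset.Ioi i, (x i.succ - x j.succ)) *
        ((∏ i : Fin k, revEval m f (x i.succ)) *
          schurLin (ExtVertex.minusIter (fun j => x j.succ) H) (m + k) (contractβ n u))) := by
        rw [h3, Finset.mul_sum, Finset.mul_sum]
        exact Finset.sum_congr rfl fun n _ => by ring
      _ = _ := by
        simp only [h4]
        rw [← Fin.sum_univ_eq_sum_range fun n => x 0 ^ n * ∑ a : Fin k → Fin N,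
          (∏ i, x i.succ ^ (a i : ℕ)) *
            schurLin H m (contractSeq (fun i => (a i : ℕ)) (contractβ n u)),
          ← Equiv.sum_comp (Fin.consEquiv fun _ => Fin N), Fintype.sum_prod_type]
        refine Finset.sum_congr rfl fun n _ => ?_
        rw [Finset.mul_sum]
        refine Finset.sum_congr rfl fun a _ => ?_
        rw [contractSeq_succ, Fin.prod_univ_succ]
        simp only [Fin.consEquiv_apply, Fin.cons_zero, Fin.cons_succ, mul_assoc]

end Peel

lemma schurLin_map {R S : Type*} [CommRing R] [Algebra ℚ R] [CommRing S] [Algebra ℚ S]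
    (φ : R →ₐ[ℚ] S) (H : ℤ → R) {r : ℕ} {u : ExtV} (hu : u ∈ ⋀[ℚ]^r V) :
    schurLin (fun n => φ (H n)) r u = φ (schurLin H r u) := by
  refine exteriorPower_eqOn (g := φ.toLinearMap ∘ₗ schurLin H r) (fun n => ?_) hu
  rw [LinearMap.comp_apply, schurLin_ιMulti, schurLin_ιMulti, schurAlt_eq_det, schurAlt_eq_det,
    AlgHom.toLinearMap_apply, AlgHom.map_det]
  congr 1
  ext i j
  simp [rowVec_b]

lemma exists_contractβ_eq_zero {d : ℕ} {u : ExtV} (hu : u ∈ ⋀[ℚ]^d V) :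
    ∃ N, ∀ n, N ≤ n → contractβ n u = 0 := by
  rw [← span_ιMulti_b] at hu
  induction hu using Submodule.span_induction with
  | zero => exact ⟨0, fun n _ => map_zero _⟩
  | add u v _ _ hu hv =>
    obtain ⟨M₁, h1⟩ := hu
    obtain ⟨M₂, h2⟩ := hv
    refine ⟨max M₁ M₂, fun n hn => ?_⟩
    rw [map_add, h1 n (le_trans (le_max_left _ _) hn), h2 n (le_trans (le_max_right _ _) hn),
      add_zero]
  | smul c u _ hu =>
    obtain ⟨M₁, h1⟩ := hu
    exact ⟨M₁, fun n hn => by rw [map_smul, h1 n hn, smul_zero]⟩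
  | mem u hu =>
    obtain ⟨w, rfl⟩ := hu
    rcases d with _ | d
    · exact ⟨0, fun n _ => by
        simp only [ιMulti_zero_apply]
        exact CliffordAlgebra.contractLeft_one (Q := (0 : QuadraticForm ℚ V)) (d := β n)⟩
    · refine ⟨∑ i, w i + 1, fun n hn => ?_⟩
      rw [contractβ, contractLeft_ιMulti]
      refine Finset.sum_eq_zero fun p _ => ?_
      have : w p ≤ ∑ i, w i := Finset.single_le_sum
        (f := w) (fun _ _ => Nat.zero_le _) (Finset.mem_univ p)
      rw [β_b, if_neg (by omega), mul_zero, zero_smul]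

/-- The map from the exterior algebra of the dual to the opposite of `End (⋀V)` given by
contractions. -/
def contractHom : ExteriorAlgebra ℚ (Module.Dual ℚ V) →ₐ[ℚ] (Module.End ℚ ExtV)ᵐᵒᵖ :=
  ExteriorAlgebra.lift ℚ ⟨(MulOpposite.opLinearEquiv ℚ).toLinearMap ∘ₗ
    (CliffordAlgebra.contractLeft (Q := (0 : QuadraticForm ℚ V))), fun d => by
      rw [LinearMap.comp_apply, LinearEquiv.coe_coe, MulOpposite.coe_opLinearEquiv,
        ← MulOpposite.op_mul, MulOpposite.op_eq_zero_iff]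
      exact LinearMap.ext fun u => CliffordAlgebra.contractLeft_contractLeft (d := d) u⟩

lemma contractHom_ιMulti {k : ℕ} (a : Fin k → ℕ) :
    contractHom (ιMulti ℚ k (β ∘ a)) = MulOpposite.op (contractSeq a) := by
  rw [ιMulti_apply, map_list_prod, List.map_ofFn, contractSeq, MulOpposite.op_list_prod,
    List.map_reverse, List.reverse_reverse, List.map_ofFn]
  congr 1
  congr 1
  ext1 i
  exact ExteriorAlgebra.lift_ι_apply ℚ _ _ _

/-- Contractions anticommute and square to 0, hence factor through the exterior algebra of the dual.
The opposite algebra appears because the first form acts first. -/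
lemma isAlternatingFun_contractSeq {S : Type*} [AddCommGroup S] [Module ℚ S] (F : ExtV →ₗ[ℚ] S)
    (k : ℕ) (u : ExtV) : IsAlternatingFun fun a : Fin k → ℕ => F (contractSeq a u) := by
  have := isAlternatingFun_of_alternatingMap (((F ∘ₗ LinearMap.applyₗ u ∘ₗ
    (MulOpposite.opLinearEquiv ℚ).symm.toLinearMap ∘ₗ contractHom.toLinearMap)).compAlternatingMap
      (ιMulti ℚ k)) β
  convert this using 2 with a
  simp only [LinearMap.compAlternatingMap_apply, LinearMap.comp_apply, AlgHom.toLinearMap_apply,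
    contractHom_ιMulti]
  rfl

/-! ### The action of σ̄₊(w_k) as a product of reversed polynomials. -/

lemma IsInverseSeq.map {R S : Type*} [CommRing R] [CommRing S] (φ : R →+* S) {m : ℕ} {f : ℕ → R}
    {H : ℤ → R} (h : IsInverseSeq m f H) :
    IsInverseSeq m (fun i => φ (f i)) (fun n => φ (H n)) where
  coeff_zero := by rw [h.coeff_zero, map_one]
  of_neg n hn := by rw [h.of_neg n hn, map_zero]
  sum_eq n := by
    simp only [← map_mul, ← map_sum, h.sum_eq]
    split_ifs <;> simp

/-- The polynomial `∏_j x_j^m E_m(x_j⁻¹)`. -/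
def revEpsProd (k m : ℕ) : MvPolynomial (Fin k) (B m) :=
  ∏ j, revEval m (fun i => MvPolynomial.C (eps m i)) (MvPolynomial.X j)

lemma coeff_revEpsProd {k m : ℕ} (t : Fin k →₀ ℕ) :
    (revEpsProd k m).coeff t = ∏ j, eps m ((m : ℤ) - t j) := by
  have h1 : revEpsProd k m = ∑ p ∈ Fintype.piFinset fun _ : Fin k => Finset.range (m + 1),
      MvPolynomial.monomial (Finsupp.equivFunOnFinite.symm p) (∏ j, eps m ((m : ℤ) - p j)) := by
    have (j : Fin k) : revEval m (fun i => MvPolynomial.C (eps m i))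
        (MvPolynomial.X j : MvPolynomial (Fin k) (B m)) =
        ∑ i ∈ Finset.range (m + 1), MvPolynomial.C (eps m ((m : ℤ) - i)) * MvPolynomial.X j ^ i := by
      rw [revEval, ← Finset.sum_range_reflect]
      refine Finset.sum_congr rfl fun i hi => ?_
      have : i ≤ m := by simpa [Nat.lt_succ_iff] using hi
      rw [show m + 1 - 1 - i = m - i by omega, show m - (m - i) = i by omega, Nat.cast_sub this]
    rw [revEpsProd]
    simp only [this]
    rw [Finset.prod_univ_sum]
    refine Finset.sum_congr rfl fun p _ => ?_
    rw [Finset.prod_mul_distrib, ← map_prod, MvPolynomial.monomial_eq,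
      Finsupp.prod_fintype _ _ (by simp)]
    rfl
  rw [h1, MvPolynomial.coeff_sum]
  simp only [MvPolynomial.coeff_monomial]
  by_cases ht : ∀ j, t j ≤ m
  · rw [Finset.sum_eq_single (t : Fin k → ℕ)]
    · simp
    · intro p _ hp
      rw [if_neg]
      rintro rfl
      exact hp rfl
    · intro h
      exact absurd (Fintype.mem_piFinset.2 fun j => by simpa [Nat.lt_succ_iff] using ht j) h
  · push Not at ht
    obtain ⟨j, hj⟩ := ht
    rw [Finset.prod_eq_zero (Finset.mem_univ j) (eps_of_neg (by omega))]
    refine Finset.sum_eq_zero fun p hp => ?_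
    rw [if_neg]
    rintro rfl
    have := Fintype.mem_piFinset.1 hp j
    simp at this hj
    omega

lemma multi_sigmaBarPlus_toWedge {k m : ℕ} (c : Fin k → ℤ) (p : B m) :
    multi sigmaBarPlus c (toWedge m p) = toWedge m ((∏ j, eps m (c j)) * p) := by
  induction k with
  | zero => simp [multi_zero]
  | succ k ih => rw [multi_succ, ih, sigmaBarPlus_toWedge, Fin.prod_univ_succ, mul_assoc]

lemma barPlusCoeff_monomial {k m : ℕ} (c : Fin k → ℤ) (s : Fin k →₀ ℕ) (p : B m) :
    barPlusCoeff k m c (MvPolynomial.monomial s p) =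
      toWedge m ((∏ j, eps m (c j + s j)) * p) := by
  rw [← multi_sigmaBarPlus_toWedge]
  exact Finsupp.sum_single_index (map_zero _)

lemma barPlusCoeff_eq_zero {k m : ℕ} {c : Fin k → ℤ} {j : Fin k} (hj : (m : ℤ) < c j)
    (P : MvPolynomial (Fin k) (B m)) : barPlusCoeff k m c P = 0 := by
  induction P using MvPolynomial.induction_on' with
  | monomial s p =>
    rw [barPlusCoeff_monomial, Finset.prod_eq_zero (Finset.mem_univ j) (eps_of_gt (by omega)),
      zero_mul, map_zero]
  | add P Q hP hQ => rw [map_add, hP, hQ, add_zero]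

/-- σ̄₊(w_j) acts as E_m(w_j), and w_j = x_j⁻¹: the coefficient of w_j^{m-a_j} is that of x_j^{a_j}
after multiplication by x_j^m. -/
lemma barPlusCoeff_eq_coeff {k m : ℕ} (a : Fin k →₀ ℕ) (P : MvPolynomial (Fin k) (B m)) :
    barPlusCoeff k m (fun j => (m : ℤ) - a j) P = toWedge m ((revEpsProd k m * P).coeff a) := by
  induction P using MvPolynomial.induction_on' with
  | monomial s p =>
    rw [barPlusCoeff_monomial, MvPolynomial.coeff_mul_monomial']
    split_ifs with h
    · rw [coeff_revEpsProd]
      congr 2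
      refine Finset.prod_congr rfl fun j _ => ?_
      have := h j
      congr 1
      rw [Finsupp.tsub_apply, Nat.cast_sub this]
      ring
    · rw [Finsupp.le_def] at h
      push Not at h
      obtain ⟨j, hj⟩ := h
      rw [Finset.prod_eq_zero (Finset.mem_univ j) (eps_of_gt (by omega)), zero_mul]
  | add P Q hP hQ => rw [map_add, hP, hQ, mul_add, MvPolynomial.coeff_add, map_add]

lemma vandermondeSeries_eq (k : ℕ) (S : Type*) [CommRing S] [Algebra ℚ S] :
    vandermondeSeries k S = ((∏ i : Fin k, ∏ j ∈ Finset.Ioi i,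
      (MvPolynomial.X i - MvPolynomial.X j) : MvPolynomial (Fin k) S) : MvPowerSeries (Fin k) S) := by
  rw [vandermondeSeries, altDet_zero]
  simp only [map_prod, map_sub, MvPolynomial.map_X]

lemma schurDet_minusH {k m : ℕ} (l : Fin (m + k) → ℕ) : schurDet (minusH k m) l =
    schurLin (minusIter (R := MvPolynomial (Fin k) (B m)) MvPolynomial.X
      fun n => MvPolynomial.C (hSeq m n)) (m + k) (bWedge l) := by
  rw [bWedge, schurLin_ιMulti, schurAlt_apply]
  rfl

/-- The Vandermonde product times this polynomial is ∑_a x^a times the contraction against β_{a_1} ∧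
⋯ ∧ β_{a_k}, an alternating function of a, so `coeff_eq_finsum_schur` applies. -/
lemma coeff_revEpsProd_mul_schurDet {k m : ℕ} (l : Fin (m + k) → ℕ) (a : Fin k →₀ ℕ) :
    (revEpsProd k m * schurDet (minusH k m) l).coeff a =
      ∑ᶠ n : Ptn k, (schur n.1).coeff a • ofWedge m (contract n.1 (bWedge l)) := by
  have hΨ := isAlternatingFun_contractSeq (ofWedge m) k (bWedge l)
  have hmem := bWedge_mem l
  obtain ⟨N, hN⟩ := exists_contractβ_eq_zero hmem
  have h1 := ((isInverseSeq_hSeq m).map (MvPolynomial.C (σ := Fin k))).prod_mul_schurLin_minusIter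
    MvPolynomial.X hmem hN
  rw [← schurDet_minusH] at h1
  have h2 := coeff_eq_finsum_schur hΨ
    (g := ((revEpsProd k m * schurDet (minusH k m) l : MvPolynomial (Fin k) (B m)) :
      MvPowerSeries (Fin k) (B m))) (fun a => ?_) a
  · rw [← MvPolynomial.coeff_coe, h2]
    rfl
  · rw [vandermondeSeries_eq, ← MvPolynomial.coe_mul, MvPolynomial.coeff_coe, revEpsProd, h1,
      MvPolynomial.coeff_sum]
    have h3 (c : Fin k → Fin N) : MvPolynomial.coeff a
        ((∏ i, (MvPolynomial.X i : MvPolynomial (Fin k) (B m)) ^ (c i : ℕ)) *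
          schurLin (fun n => MvPolynomial.C (hSeq m n)) m
            (contractSeq (fun i => (c i : ℕ)) (bWedge l))) =
        if (fun i => (c i : ℕ)) = a then
          ofWedge m (contractSeq (fun i => (c i : ℕ)) (bWedge l)) else 0 := by
      have h4 := schurLin_map (Algebra.ofId (B m) (MvPolynomial (Fin k) (B m)) |>.restrictScalars ℚ)
        (hSeq m) (contractSeq_mem (fun i => (c i : ℕ)) hmem)
      have h5 : schurLin (fun n => MvPolynomial.C (σ := Fin k) (hSeq m n)) m
          (contractSeq (fun i => (c i : ℕ)) (bWedge l)) =
          MvPolynomial.C (ofWedge m (contractSeq (fun i => (c i : ℕ)) (bWedge l))) := h4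
      have h6 : ∏ i, (MvPolynomial.X i : MvPolynomial (Fin k) (B m)) ^ (c i : ℕ) =
          MvPolynomial.monomial (Finsupp.equivFunOnFinite.symm fun i => (c i : ℕ)) 1 := by
        rw [MvPolynomial.monomial_eq, Finsupp.prod_fintype _ _ (by simp)]
        simp
      rw [h5, h6, mul_comm, MvPolynomial.C_mul_monomial, MvPolynomial.coeff_monomial, mul_one]
      refine if_congr ?_ rfl rfl
      rw [Equiv.symm_apply_eq]
      rfl
    rw [Finset.sum_congr rfl fun c _ => h3 c]
    by_cases ha : ∀ i, a i < N
    · rw [Finset.sum_eq_single fun i => ⟨a i, ha i⟩]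
      · exact if_pos rfl
      · intro c _ hc
        exact if_neg fun h => hc (funext fun i => Fin.ext (congrFun h i))
      · simp
    · rw [Finset.sum_eq_zero fun c _ => if_neg fun h => ha fun i => by
        rw [← congrFun h i]; exact (c i).2]
      push Not at ha
      obtain ⟨i, hi⟩ := ha
      -- Exponents outside the finite range of summation also have to match: there the contraction
      -- vanishes by the choice of N.
      have hzero {k : ℕ} (a : Fin k → ℕ) {i : Fin k} (hi : N ≤ a i) {u : ExtV}
          (hN : ∀ n, N ≤ n → contractβ n u = 0) : contractSeq a u = 0 := by
        induction k generalizing u with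
        | zero => exact i.elim0
        | succ k ih =>
          rw [contractSeq_succ]
          induction i using Fin.cases with
          | zero => rw [hN _ hi, map_zero]
          | succ i => exact ih (fun i => a i.succ) hi (contractβ_contractβ_eq_zero hN _)
      rw [hzero (⇑a) hi hN, map_zero]

lemma GammaStar_bWedge_eq {k m r : ℕ} (hr : r = m + k) (c : Fin k → ℤ) (l : Fin r → ℕ) :
    GammaStar k (fun j => c j + m) (bWedge l) =
      ∑ᶠ n : Ptn k, coeffZ (schur n.1) (-c) • contract n.1 (bWedge l) := by
  have h1 : GammaStar k (fun j => c j + m) (bWedge l) =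
      barPlusCoeff k m (fun j => c j + m) (schurDet (minusH k m) l) := by
    obtain rfl : m = r - k := by omega
    exact GammaStar_bWedge k _ (by omega) l
  subst hr
  rw [h1]
  by_cases h : ∀ j, 0 ≤ (-c) j
  · obtain ⟨a, ha⟩ : ∃ a : Fin k →₀ ℕ, -c = fun j => (a j : ℤ) :=
      ⟨Finsupp.equivFunOnFinite.symm fun j => (-c j).toNat, by
        ext j
        have := h j
        simp only [Pi.neg_apply] at this
        simp only [Pi.neg_apply, Finsupp.equivFunOnFinite_symm_apply_apply]
        omega⟩
    have hc : (fun j => c j + (m : ℤ)) = fun j => (m : ℤ) - a j := by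
      ext j
      have := congrFun ha j
      simp only [Pi.neg_apply] at this
      omega
    have hfin : (Function.support fun n : Ptn k =>
        (schur n.1).coeff a • ofWedge m (contract n.1 (bWedge l))).Finite :=
      (coeff_schur_finite a).subset fun n hn => left_ne_zero_of_smul hn
    rw [hc, barPlusCoeff_eq_coeff, coeff_revEpsProd_mul_schurDet, ha]
    refine ((toWedge m).toAddMonoidHom.map_finsum hfin).trans (finsum_congr fun n => ?_)
    rw [LinearMap.toAddMonoidHom_coe, map_smul, coeffZ_natCast,
      contract_eq_contractSeq, toWedge_ofWedge (contractSeq_mem (idx n.1) (bWedge_mem l))]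
  · have h' := h
    push Not at h'
    obtain ⟨j, hj⟩ := h'
    -- Here c_j > 0, so the exponent c_j + m of w_j exceeds the degree m of E_m(w_j), while the
    -- other factor involves only powers of w_j⁻¹.
    rw [barPlusCoeff_eq_zero (j := j) (by simp at hj; omega)]
    simp only [coeffZ, if_neg h, zero_smul, finsum_zero]

/-! ### The action of `gl` -/

lemma contract_mem {k r : ℕ} (hkr : k ≤ r) (n : Fin k → ℕ) {u : ExtV} (hu : u ∈ ⋀[ℚ]^r V) :
    contract n u ∈ ⋀[ℚ]^(r - k) V := by
  obtain ⟨m, rfl⟩ := Nat.exists_eq_add_of_le' hkr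
  rw [Nat.add_sub_cancel]
  exact contractSeq_mem (idx n) hu

lemma contractSeq_eq_zero {k r : ℕ} (hrk : r < k) (n : Fin k → ℕ) {u : ExtV}
    (hu : u ∈ ⋀[ℚ]^r V) : contractSeq n u = 0 := by
  induction k generalizing r u with
  | zero => omega
  | succ k ih =>
    rw [contractSeq_succ]
    rcases r with _ | r
    · rw [← ιMulti_span_fixedDegree] at hu
      have h1 : contractβ (n 0) u = 0 := by
        induction hu using Submodule.span_induction with
        | zero => exact map_zero _
        | add u v _ _ hu hv => rw [map_add, hu, hv, add_zero]
        | smul c u _ hu => rw [map_smul, hu, smul_zero]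
        | mem u hu =>
          obtain ⟨w, rfl⟩ := hu
          rw [ιMulti_zero_apply]
          exact CliffordAlgebra.contractLeft_one (Q := (0 : QuadraticForm ℚ V)) (d := β (n 0))
      rw [h1, map_zero]
    · exact ih (by omega) _ (contractLeft_mem _ hu)

lemma toWedge_glAct {k r : ℕ} (m n : Fin k → ℕ) (p : B r) :
    toWedge r (glAct r m n p) = bWedge m * contract n (toWedge r p) := by
  refine toWedge_ofWedge ?_
  have hp := toWedge_mem r p
  simp only [LinearMap.comp_apply, LinearMap.mulLeft_apply]
  rcases le_or_gt k r with h | h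
  · have := mul_mem_exteriorPower (bWedge_mem m) (contract_mem h n hp)
    rwa [Nat.add_sub_cancel' h] at this
  · have : contract n (toWedge r p) = 0 := contractSeq_eq_zero h (idx n) hp
    rw [this, mul_zero]
    exact zero_mem _

/-- The coefficient of ℰ_{μν} and its action both split into a part in μ and a part in ν, so the
double sum is a product. -/
lemma toWedge_genAct {k r : ℕ} (a c : Fin k → ℤ) (p : B r) : toWedge r (genAct k r a c p) =
    (∑ᶠ m : Ptn k, coeffZ (schur m.1) a • bWedge m.1) *
      ∑ᶠ n : Ptn k, coeffZ (schur n.1) (-c) • contract n.1 (toWedge r p) := by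
  have hfin1 : (Function.support fun m : Ptn k => coeffZ (schur m.1) a • bWedge m.1).Finite :=
    (coeffZ_schur_finite a).subset fun m hm => left_ne_zero_of_smul hm
  have hfin2 : (Function.support fun n : Ptn k =>
      coeffZ (schur n.1) (-c) • contract n.1 (toWedge r p)).Finite :=
    (coeffZ_schur_finite (-c)).subset fun m hm => left_ne_zero_of_smul hm
  have h1 := (toWedge r).toAddMonoidHom.map_finsum (genAct_support_finite k r a c p)
  have h2 (q : Ptn k × Ptn k) : toWedge r
      ((coeffZ (schur q.1.1) a * coeffZ (schur q.2.1) (-c)) • glAct r q.1.1 q.2.1 p) =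
      (coeffZ (schur q.1.1) a • bWedge q.1.1) *
        (coeffZ (schur q.2.1) (-c) • contract q.2.1 (toWedge r p)) := by
    rw [map_smul, toWedge_glAct, smul_mul_smul_comm]
  rw [genAct]
  refine h1.trans ?_
  simp only [LinearMap.toAddMonoidHom_coe, h2]
  rw [finsum_curry]
  · refine Eq.trans ?_ ((AddMonoidHom.mulRight (∑ᶠ n : Ptn k,
      coeffZ (schur n.1) (-c) • contract n.1 (toWedge r p))).map_finsum hfin1).symm
    exact finsum_congr fun m =>
      ((AddMonoidHom.mulLeft (coeffZ (schur m.1) a • bWedge m.1)).map_finsum hfin2).symm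
  · exact (hfin1.prod hfin2).subset fun q hq =>
      ⟨left_ne_zero_of_mul hq, right_ne_zero_of_mul hq⟩

lemma toWedge_genAct_schurDet {k r : ℕ} (l : Fin r → ℕ) (a c : Fin k → ℤ) :
    toWedge r (genAct k r a c (schurDet (hSeq r) l)) =
      Gamma k (fun j => a j - ((r : ℤ) - (k : ℤ)))
        (GammaStar k (fun j => c j + ((r : ℤ) - (k : ℤ))) (bWedge l)) := by
  rw [toWedge_genAct, toWedge_schurDet]
  rcases le_or_gt k r with h | h
  · obtain ⟨m, rfl⟩ := Nat.exists_eq_add_of_le' h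
    have hm : ((m + k : ℕ) : ℤ) - k = m := by push_cast; ring
    have hmem : ∑ᶠ n : Ptn k, coeffZ (schur n.1) (-c) • contract n.1 (bWedge l) ∈ ⋀[ℚ]^m V :=
      finsum_induction (· ∈ ⋀[ℚ]^m V) (zero_mem _) (fun _ _ => add_mem)
        fun n => Submodule.smul_mem _ _ (contractSeq_mem (idx n.1) (bWedge_mem l))
    simp only [hm]
    -- Γ* lowers the degree to m = r - k, so the shift by the degree in `Gamma_eq` cancels the given
    -- shift of the exponents of z.
    rw [GammaStar_bWedge_eq rfl, Gamma_eq _ hmem]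
    simp only [sub_add_cancel]
    rw [multi_sigmaPlus_bWedge_zero]
  · have h1 (n : Ptn k) : contract n.1 (bWedge l) = 0 :=
      contractSeq_eq_zero h (idx n.1) (bWedge_mem l)
    have h2 (c : Fin k → ℤ) : GammaStar k c (bWedge l) = 0 := by
      rw [GammaStar, bWedge, liftAlternating_apply_ιMulti, if_neg (not_le.2 h)]
      rfl
    simp only [h1, h2, smul_zero, finsum_zero, mul_zero]
    simp [Gamma]

end ExtVertex

end

theorem mainTheorem1 (k r : ℕ) (l : Fin r → ℕ) (hl : Antitone l) :
    -- `p ↦ p [b]^r_0` is a bijection of `B_r` onto `⋀^r V` that sends `Δ_λ(H_r)` to `[b]^r_λ`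
    Set.BijOn (ExtVertex.toWedge r) Set.univ
        ((⋀[ℚ]^r ExtVertex.V : Submodule ℚ ExtVertex.ExtV) : Set ExtVertex.ExtV) ∧
    ExtVertex.toWedge r (ExtVertex.schurDet (ExtVertex.hSeq r) l) = ExtVertex.bWedge l ∧
    -- `(ℰ^k_{μν} Δ_λ(H_r)) [b]^r_0 = [b]^k_μ ∧ ([β]^k_ν ⌟ [b]^r_λ)`
    (∀ m n : ExtVertex.Ptn k,
      ExtVertex.toWedge r
          (ExtVertex.glAct r m.1 n.1 (ExtVertex.schurDet (ExtVertex.hSeq r) l)) =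
        ExtVertex.bWedge m.1 * ExtVertex.contract n.1 (ExtVertex.bWedge l)) ∧
    -- for `r ≥ 1`, `σ₋(z) (h_n [b]^r_0) = ∑_{i ≥ 0} (h_{n-i} [b]^r_0) z^{-i}`
    (1 ≤ r → ∀ (n : ℤ) (i : ℕ),
      ExtVertex.sigmaMinus (-(i : ℤ)) (ExtVertex.toWedge r (ExtVertex.hSeq r n)) =
        ExtVertex.toWedge r (ExtVertex.hSeq r (n - (i : ℤ)))) ∧
    -- the coefficients of `z^a w^c` in `(ℰ(z_k, w_k⁻¹) Δ_λ(H_r)) [b]^r_0` and in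
    -- `∏_j (z_j / w_j)^{r-k} Γ(z_k) Γ*(w_k) [b]^r_λ` agree
    ∀ a c : Fin k → ℤ,
      ExtVertex.toWedge r
          (ExtVertex.genAct k r a c (ExtVertex.schurDet (ExtVertex.hSeq r) l)) =
        ExtVertex.Gamma k (fun j => a j - ((r : ℤ) - (k : ℤ)))
          (ExtVertex.GammaStar k (fun j => c j + ((r : ℤ) - (k : ℤ))) (ExtVertex.bWedge l)) := by
  refine ⟨ExtVertex.toWedge_bijOn r, ExtVertex.toWedge_schurDet l, fun m n => ?_,
    fun hr n i => ExtVertex.sigmaMinus_toWedge_hSeq hr n i,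
    fun a c => ExtVertex.toWedge_genAct_schurDet l a c⟩
  rw [ExtVertex.toWedge_glAct, ExtVertex.toWedge_schurDet]
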